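/- Let $P\subset\mathbb{R}^3$ be a bounded Lipschitz domain, that is, a bounded open set (connectedness is not needed) which, near each of its boundary points and in suitable orthonormal coordinates, is the set of points lying strictly below the graph of a Lipschitz function of the first two coordinates. Let $\mathbf 1_P$ be its characteristic function, and let $r\in\,]0,1[$. Let $\chi,\varphi\in C^\infty_c(\mathbb{R}^3)$ be real-valued, with $\varphi$ vanishing near the origin and $\chi(\xi)+\sum_{n\ge 0}\varphi(2^{-n}\xi)=1$ for all $\xi\in\mathbb{R}^3$ (a dyadic partition of unity). Set $\Delta_{-1}=\chi(D)$, $\Delta_n=\varphi(2^{-n}D)$ and $S_n=\chi(2^{-n}D)$ for $n\ge 0$, and let $$C^{r-1}(\mathbb{R}^3)=B^{r-1}_{\infty,\infty}(\mathbb{R}^3)=\Big\{f\in\mathcal S'(\mathbb{R}^3)\;:\;\|f\|_{C^{r-1}}=\sup_{n\ge -1}2^{n(r-1)}\|\Delta_n f\|_{L^\infty}<\infty\Big\}.$$ Then pointwise multiplication by $\mathbf 1_P$ is a continuous linear mapping from $C^{r-1}(\mathbb{R}^3)$ into $C^{r-1}(\mathbb{R}^3)$. Explicitly, there is a continuous linear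 map $M:C^{r-1}(\mathbb{R}^3)\to C^{r-1}(\mathbb{R}^3)$ such that, for every $f\in C^{r-1}(\mathbb{R}^3)$, $Mf$ is the product $\mathbf 1_P f$, in the sense that $(S_n\mathbf 1_P)(S_nf)\to Mf$ in $\mathcal S'(\mathbb{R}^3)$ as $n\to\infty$, for every dyadic partition of unity (not only the one that defines the norm). -/

import Mathlib

open MeasureTheory TemperedDistribution Filter Topology
open scoped SchwartzMap ENNReal ContDiff

noncomputable section

/-- Three-dimensional Euclidean space. -/
abbrev R3 : Type := EuclideanSpace ℝ (Fin 3)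

/-! ### Bounded Lipschitz domains -/

/-- `P` is a bounded open subset of `ℝ³` with Lipschitz boundary: near each boundary point and in
suitable orthonormal coordinates, `P` is the set of points lying strictly below the graph of a
Lipschitz function of the first two coordinates. (Connectedness is not required.) -/
structure IsBoundedLipschitzDomain (P : Set R3) : Prop where
  isOpen : IsOpen P
  isBounded : Bornology.IsBounded P
  lipschitz_boundary : ∀ x ∈ frontier P,
    ∃ (e : R3 ≃ₗᵢ[ℝ] R3) (ψ : EuclideanSpace ℝ (Fin 2) → ℝ) (K : NNReal) (U : Set R3),
      LipschitzWith K ψ ∧ U ∈ 𝓝 x ∧ ∀ y ∈ U, y ∈ P ↔ e y 2 < ψ !₂[e y 0, e y 1]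

/-- The characteristic function of a bounded Lipschitz domain, as an essentially bounded function.
-/
def IsBoundedLipschitzDomain.indicator {P : Set R3} (hP : IsBoundedLipschitzDomain P) :
    Lp ℂ ∞ (volume : Measure R3) :=
  indicatorConstLp ∞ hP.isOpen.measurableSet hP.isBounded.measure_lt_top.ne (1 : ℂ)

/-! ### Littlewood–Paley decompositions -/

/-- A smooth dyadic partition of unity `χ(ξ) + ∑_{n ≥ 0} φ(2⁻ⁿ ξ) = 1` of `ℝ³`, with `χ` supported
in a ball and `φ` supported in an annulus centered at the origin. -/
structure DyadicPartition where
  χ : R3 → ℝ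
  φ : R3 → ℝ
  contDiff_χ : ContDiff ℝ ∞ χ
  contDiff_φ : ContDiff ℝ ∞ φ
  hasCompactSupport_χ : HasCompactSupport χ
  hasCompactSupport_φ : HasCompactSupport φ
  zero_notMem_tsupport_φ : (0 : R3) ∉ tsupport φ
  hasSum_one : ∀ ξ : R3, HasSum (fun n : ℕ ↦ φ (((2 : ℝ) ^ n)⁻¹ • ξ)) (1 - χ ξ)

namespace DyadicPartition

variable (Ψ : DyadicPartition)

/-- The symbols of the dyadic blocks, shifted by one: `χ` for `n = 0` (the block `Δ₋₁`) and
`φ(2⁻ᵐ ·)` for `n = m + 1` (the block `Δₘ`, `m ≥ 0`). -/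
def blockSymbol : ℕ → R3 → ℂ
  | 0 => fun ξ ↦ (Ψ.χ ξ : ℂ)
  | m + 1 => fun ξ ↦ (Ψ.φ (((2 : ℝ) ^ m)⁻¹ • ξ) : ℂ)

/-- The dyadic block `Δₙ₋₁`, acting on tempered distributions: `Δ₋₁ = χ(D)` and
`Δₘ = φ(2⁻ᵐ D)` for `m ≥ 0`. -/
def block (n : ℕ) : 𝓢'(R3, ℂ) →L[ℂ] 𝓢'(R3, ℂ) :=
  fourierMultiplierCLM ℂ (Ψ.blockSymbol n)

/-- The low-frequency cut-off `Sₙ = χ(2⁻ⁿ D) = ∑_{-1 ≤ m ≤ n - 1} Δₘ`. -/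
def lowFreq (n : ℕ) : 𝓢'(R3, ℂ) →L[ℂ] 𝓢'(R3, ℂ) :=
  fourierMultiplierCLM ℂ (fun ξ ↦ (Ψ.χ (((2 : ℝ) ^ n)⁻¹ • ξ) : ℂ))

end DyadicPartition

/-! ### Hölder–Zygmund spaces -/

/-- The `L^∞` norm of a tempered distribution: the essential supremum norm of the function that
represents it, and `∞` if it is not represented by an essentially bounded function. -/
def linftyNorm (f : 𝓢'(R3, ℂ)) : ℝ≥0∞ :=
  ⨅ (g : Lp ℂ ∞ (volume : Measure R3)) (_ : Lp.toTemperedDistribution g = f), ‖g‖ₑ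

/-- The norm of `C^s_* = B^s_{∞,∞}(ℝ³)`, that is `sup_{m ≥ -1} 2^{ms} ‖Δₘ f‖_∞` (here `m = n - 1`).
-/
def holderNorm (Ψ : DyadicPartition) (s : ℝ) (f : 𝓢'(R3, ℂ)) : ℝ≥0∞ :=
  ⨆ n : ℕ, ENNReal.ofReal ((2 : ℝ) ^ (((n : ℝ) - 1) * s)) * linftyNorm (Ψ.block n f)

theorem linftyNorm_add_le (f g : 𝓢'(R3, ℂ)) :
    linftyNorm (f + g) ≤ linftyNorm f + linftyNorm g := by
  unfold linftyNorm
  refine ENNReal.le_iInf₂_add_iInf₂ ?_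
  intro a ha b hb
  refine (iInf₂_le (a + b) ?_).trans (enorm_add_le a b)
  rw [← ha, ← hb]
  exact map_add (Lp.toTemperedDistributionCLM ℂ (volume : Measure R3) ∞) a b

theorem linftyNorm_zero : linftyNorm 0 = 0 := by
  refine le_antisymm ?_ zero_le
  refine (iInf₂_le (0 : Lp ℂ ∞ (volume : Measure R3)) ?_).trans (by simp)
  exact map_zero (Lp.toTemperedDistributionCLM ℂ (volume : Measure R3) ∞)

theorem linftyNorm_smul_le (c : ℂ) (f : 𝓢'(R3, ℂ)) :
    linftyNorm (c • f) ≤ ‖c‖ₑ * linftyNorm f := by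
  rcases eq_or_ne c 0 with rfl | hc
  · have h : (0 : ℂ) • f = 0 := zero_smul ℂ f
    rw [h, linftyNorm_zero]
    exact zero_le
  unfold linftyNorm
  have h0 : ‖c‖ₑ ≠ 0 := by simpa using hc
  rw [ENNReal.mul_iInf_of_ne h0 enorm_ne_top]
  refine le_iInf fun a ↦ ?_
  rw [ENNReal.mul_iInf_of_ne h0 enorm_ne_top]
  refine le_iInf fun ha ↦ ?_
  refine (iInf₂_le (c • a) ?_).trans (enorm_smul c a).le
  rw [← ha]
  exact map_smul (Lp.toTemperedDistributionCLM ℂ (volume : Measure R3) ∞) c a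

section

variable (Ψ : DyadicPartition) (s : ℝ)

theorem holderNorm_add_le (f g : 𝓢'(R3, ℂ)) :
    holderNorm Ψ s (f + g) ≤ holderNorm Ψ s f + holderNorm Ψ s g := by
  refine iSup_le fun n ↦ ?_
  rw [map_add]
  refine (mul_le_mul_right (linftyNorm_add_le _ _) _).trans ?_
  rw [mul_add]
  exact add_le_add (le_iSup (fun n : ℕ ↦ ENNReal.ofReal ((2 : ℝ) ^ (((n : ℝ) - 1) * s)) *
      linftyNorm (Ψ.block n f)) n)
    (le_iSup (fun n : ℕ ↦ ENNReal.ofReal ((2 : ℝ) ^ (((n : ℝ) - 1) * s)) *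
      linftyNorm (Ψ.block n g)) n)

theorem holderNorm_zero : holderNorm Ψ s 0 = 0 := by
  simp [holderNorm, linftyNorm_zero]

theorem holderNorm_smul_le (c : ℂ) (f : 𝓢'(R3, ℂ)) :
    holderNorm Ψ s (c • f) ≤ ‖c‖ₑ * holderNorm Ψ s f := by
  refine iSup_le fun n ↦ ?_
  rw [map_smul]
  refine (mul_le_mul_right (linftyNorm_smul_le _ _) _).trans ?_
  rw [mul_left_comm]
  exact mul_le_mul_right (le_iSup (fun n : ℕ ↦ ENNReal.ofReal ((2 : ℝ) ^ (((n : ℝ) - 1) * s)) *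
      linftyNorm (Ψ.block n f)) n) _

theorem holderNorm_smul (c : ℂ) (f : 𝓢'(R3, ℂ)) :
    holderNorm Ψ s (c • f) = ‖c‖ₑ * holderNorm Ψ s f := by
  refine le_antisymm (holderNorm_smul_le Ψ s c f) ?_
  rcases eq_or_ne c 0 with rfl | hc
  · simp
  have h := holderNorm_smul_le Ψ s c⁻¹ (c • f)
  rw [inv_smul_smul₀ hc] at h
  refine (mul_le_mul_right h _).trans ?_
  rw [← mul_assoc, ← enorm_mul, mul_inv_cancel₀ hc]
  simp

/-- The tempered distributions with finite `C^s_*` norm. -/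
def holderSubmodule : Submodule ℂ 𝓢'(R3, ℂ) where
  carrier := {f | holderNorm Ψ s f < ⊤}
  add_mem' {f g} hf hg := (holderNorm_add_le Ψ s f g).trans_lt (ENNReal.add_lt_top.2 ⟨hf, hg⟩)
  zero_mem' := by simp [holderNorm_zero]
  smul_mem' c f hf :=
    (holderNorm_smul_le Ψ s c f).trans_lt (ENNReal.mul_lt_top enorm_lt_top hf)

/-- The Hölder–Zygmund space `C^s_*(ℝ³) = B^s_{∞,∞}(ℝ³)` (written `C^s(ℝ³)` if `s` is not an
integer). It carries the topology of its own norm, not that of `𝓢'(ℝ³)`. -/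
def HolderSpace : Type := holderSubmodule Ψ s

instance : AddCommGroup (HolderSpace Ψ s) := inferInstanceAs (AddCommGroup (holderSubmodule Ψ s))

instance : Module ℂ (HolderSpace Ψ s) := inferInstanceAs (Module ℂ (holderSubmodule Ψ s))

/-- The inclusion of `C^s_*(ℝ³)` in the space of tempered distributions. -/
def HolderSpace.toDistribution : HolderSpace Ψ s →ₗ[ℂ] 𝓢'(R3, ℂ) := (holderSubmodule Ψ s).subtype

theorem HolderSpace.holderNorm_ne_top (f : HolderSpace Ψ s) :
    holderNorm Ψ s (toDistribution Ψ s f) ≠ ⊤ :=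
  (show holderNorm Ψ s (toDistribution Ψ s f) < ⊤ from f.2).ne

instance : Norm (HolderSpace Ψ s) where
  norm f := (holderNorm Ψ s (HolderSpace.toDistribution Ψ s f)).toReal

theorem HolderSpace.norm_core : SeminormedSpace.Core ℂ (HolderSpace Ψ s) where
  norm_nonneg _ := ENNReal.toReal_nonneg
  norm_smul c f := by
    change (holderNorm Ψ s (toDistribution Ψ s (c • f))).toReal =
      ‖c‖ * (holderNorm Ψ s (toDistribution Ψ s f)).toReal
    rw [map_smul, holderNorm_smul, ENNReal.toReal_mul, toReal_enorm]
  norm_triangle f g := by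
    change (holderNorm Ψ s (toDistribution Ψ s (f + g))).toReal ≤
      (holderNorm Ψ s (toDistribution Ψ s f)).toReal +
        (holderNorm Ψ s (toDistribution Ψ s g)).toReal
    rw [map_add, ← ENNReal.toReal_add (holderNorm_ne_top Ψ s f) (holderNorm_ne_top Ψ s g)]
    exact ENNReal.toReal_mono
      (ENNReal.add_ne_top.2 ⟨holderNorm_ne_top Ψ s f, holderNorm_ne_top Ψ s g⟩)
      (holderNorm_add_le Ψ s _ _)

instance : SeminormedAddCommGroup (HolderSpace Ψ s) :=
  SeminormedAddCommGroup.ofCore (HolderSpace.norm_core Ψ s)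

instance : NormedSpace ℂ (HolderSpace Ψ s) where
  norm_smul_le c f := ((HolderSpace.norm_core Ψ s).norm_smul c f).le

end

/-! ### Products of tempered distributions -/

/-- The tempered distribution `w` is the product `u f` of `u` and `f`: for every dyadic partition
of unity, the products `Sₙu · Sₙf` converge to `w` in `𝓢'(ℝ³)`. Here `Sₙu` is the smooth function
`a n` of temperate growth that represents the distribution `Sₙu` (whose spectrum is compact), so
that its product with a tempered distribution is the usual one. -/
def IsProduct (u f w : 𝓢'(R3, ℂ)) : Prop :=
  ∀ Ψ : DyadicPartition, ∃ (a : ℕ → R3 → ℂ) (ha : ∀ n, (a n).HasTemperateGrowth),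
    (∀ n, Function.HasTemperateGrowth.toTemperedDistribution volume (ha n) = Ψ.lowFreq n u) ∧
    Tendsto (fun n ↦ smulLeftCLM ℂ (a n) (Ψ.lowFreq n f)) atTop (𝓝 w)

end

/-!
The characteristic function `u` of a bounded Lipschitz domain has bounded variation, uniformly at
all scales: in every ball of radius `ρ ≤ 1` the function `u (· - h) - u` has integral `O(ρ² ‖h‖)`,
because it is supported in finitely many strips of height `O(‖h‖)` around Lipschitz graphs. The
definition `HasBVBound` expresses this with polynomially decaying weights in place of balls, and
`IsBoundedLipschitzDomain.exists_hasBVBound_indicator` proves it.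

Everything rests on one estimate, `DyadicPartition.exists_pairing_bound`: if `F` is a bounded
function of frequency `2ⁿ` and `g` is a bump of width `1 / l ≤ 1` with integral `O(1)`, then
`∫ u g F = O(‖F‖_∞ min (1, l 2⁻ⁿ))`. Indeed `F = k * F` for a kernel `k` of mean zero and of width
`2⁻ⁿ`, so only the oscillation of `u g` over distances `2⁻ⁿ` contributes, and by the Leibniz rule
the translation moduli of `u g` in `L¹` are `O(l ‖h‖)`.

Let `f ∈ C^{r-1}`, with blocks `F_n = O(2^{n (1 - r)})`. The value at `x` of the block of frequency
`2ʲ` of `u F_n` is the pairing of `u F_n` with a bump of width `2⁻ʲ` around `x`, hence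
`O(2^{n (1 - r)} min (1, 2^{j - n}))`. Since `0 < 1 - r < 1`, the sum over `n` is
`O(2^{j (1 - r)})`, so that `w = ∑ u F_n` converges in the sense of distributions and defines an
element of `C^{r-1}` whose norm is at most a constant times that of `f`
(`DyadicPartition.exists_product_series`).

For an arbitrary dyadic partition with cut-offs `S_n`, the functions `S_n u` satisfy the same
bounds of the variation as `u`, up to a constant. Therefore the series of the pairings
`∫ (S_n u) g (S_n F_m)` over `m` is dominated uniformly in `n`, and each of its terms tends to
`∫ u g F_m`, because `S_n F_m = F_m` for large `n` and `S_n u → u` in weighted `L¹`. Dominated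
convergence gives `(S_n u) (S_n f) → w` (`DyadicPartition.tendsto_smulLeft_lowFreq`). In particular
`w` is a limit of expressions that are linear in `f`, and so it depends linearly on `f`.
-/

noncomputable section

open scoped NNReal FourierTransform

/-! ### Polynomial weights -/

/-- The weight `(1 + ‖y‖)⁻⁴`, integrable in dimension at most three. -/
def decayWeight {E : Type*} [NormedAddCommGroup E] (y : E) : ℝ≥0∞ := ((1 + ‖y‖ₑ) ^ 4)⁻¹

section decayWeight

variable {E : Type*} [NormedAddCommGroup E]

theorem measurable_decayWeight [MeasurableSpace E] [BorelSpace E] :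
    Measurable (decayWeight : E → ℝ≥0∞) := by
  unfold decayWeight
  fun_prop

theorem decayWeight_le_of_norm_le {F : Type*} [NormedAddCommGroup F] {x : E} {y : F}
    (h : ‖x‖ ≤ ‖y‖) : decayWeight y ≤ decayWeight x := by
  unfold decayWeight
  have h' : ‖x‖ₑ ≤ ‖y‖ₑ := enorm_le_iff_norm_le.2 h
  gcongr

theorem decayWeight_eq_ofReal (y : E) :
    decayWeight y = ENNReal.ofReal ((1 + ‖y‖) ^ (-(4 : ℝ))) := by
  have h : 0 < 1 + ‖y‖ := by positivity
  have h4 : (1 + ‖y‖) ^ (4 : ℝ) = (1 + ‖y‖) ^ (4 : ℕ) := by exact_mod_cast Real.rpow_natCast _ 4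
  rw [decayWeight, Real.rpow_neg h.le, ENNReal.ofReal_inv_of_pos (by positivity), h4,
    ENNReal.ofReal_pow h.le, ENNReal.ofReal_add zero_le_one (norm_nonneg _), ofReal_norm,
    ENNReal.ofReal_one]

variable [NormedSpace ℝ E] [FiniteDimensional ℝ E] [MeasurableSpace E] [BorelSpace E]
  (μ : Measure E) [μ.IsAddHaarMeasure]

theorem lintegral_decayWeight_lt_top (hE : Module.finrank ℝ E < 4) :
    ∫⁻ y : E, decayWeight y ∂μ < ⊤ := by
  simp_rw [decayWeight_eq_ofReal]
  exact finite_integral_one_add_norm (by exact_mod_cast hE)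

theorem lintegral_pow_mul_comp_smul (F : E → ℝ≥0∞) {l : ℝ≥0} (hl : l ≠ 0) :
    ∫⁻ y, (l : ℝ≥0∞) ^ Module.finrank ℝ E * F ((l : ℝ) • y) ∂μ = ∫⁻ y, F y ∂μ := by
  have hl' : (l : ℝ) ≠ 0 := by exact_mod_cast hl
  have h := Measure.map_addHaar_smul μ hl'
  have hm : MeasurableEmbedding (fun x : E ↦ (l : ℝ) • x) := measurableEmbedding_const_smul₀ hl'
  have h2 : ∫⁻ y, F ((l : ℝ) • y) ∂μ =
      ENNReal.ofReal |((l : ℝ) ^ Module.finrank ℝ E)⁻¹| * ∫⁻ y, F y ∂μ := by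
    rw [← hm.lintegral_map, h, lintegral_smul_measure, smul_eq_mul]
  have hpos : 0 < (l : ℝ) ^ Module.finrank ℝ E := by positivity
  rw [lintegral_const_mul' _ _ (by finiteness), h2, ← mul_assoc, abs_of_pos (by positivity),
    ENNReal.ofReal_inv_of_pos hpos, ENNReal.ofReal_pow l.coe_nonneg, ENNReal.ofReal_coe_nnreal,
    ENNReal.mul_inv_cancel (by positivity) (by finiteness), one_mul]

end decayWeight

theorem lintegral_pow_three_mul_comp_smul (F : R3 → ℝ≥0∞) {l : ℝ≥0} (hl : l ≠ 0) :
    ∫⁻ y, (l : ℝ≥0∞) ^ 3 * F ((l : ℝ) • y) = ∫⁻ y, F y := by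
  simpa using lintegral_pow_mul_comp_smul volume F hl

/-! ### Lipschitz domains have uniformly bounded variation -/

/-- The strip of half-height `c` around a graph carries at most `O(c l)` of the mass of the weight
of width `1 / l`. The weight is dominated by its values at the horizontal displacements, and the strip
has height `2c` above each point of the plane. -/
theorem lintegral_graph_strip_le {ψ : EuclideanSpace ℝ (Fin 2) → ℝ} (hψ : Continuous ψ) (c : ℝ≥0)
    {l : ℝ≥0} (hl : l ≠ 0) (x : R3) :
    ∫⁻ z : R3, (l : ℝ≥0∞) ^ 3 * decayWeight ((l : ℝ) • (x - z)) *
        {z : R3 | |z 2 - ψ !₂[z 0, z 1]| ≤ c}.indicator 1 z ≤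
      2 * c * l * ∫⁻ w : Fin 2 → ℝ, decayWeight w := by
  let x' : Fin 2 → ℝ := ![x 0, x 1]
  let S : Set (ℝ × (Fin 2 → ℝ)) := {p | |p.1 - ψ !₂[p.2 0, p.2 1]| ≤ c}
  have hS : MeasurableSet S := by
    apply IsClosed.measurableSet
    refine isClosed_le ?_ continuous_const
    have : Continuous fun p : ℝ × (Fin 2 → ℝ) ↦ (!₂[p.2 0, p.2 1] : EuclideanSpace ℝ (Fin 2)) := by
      fun_prop
    fun_prop
  let H : ℝ × (Fin 2 → ℝ) → ℝ≥0∞ := fun p ↦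
    (l : ℝ≥0∞) ^ 3 * decayWeight ((l : ℝ) • (x' - p.2)) * S.indicator 1 p
  have hW : ∀ w : Fin 2 → ℝ, (l : ℝ≥0∞) ^ 3 * decayWeight ((l : ℝ) • (x' - w)) ≠ ⊤ := by
    intro w
    rw [decayWeight_eq_ofReal]
    finiteness
  have hH : Measurable H := by
    refine Measurable.mul ?_ (measurable_one.indicator hS)
    exact (measurable_decayWeight.comp (by fun_prop)).const_mul _
  have e1 := PiLp.volume_preserving_ofLp (Fin 3)
  have e2 := volume_preserving_piFinSuccAbove (fun _ : Fin 3 ↦ ℝ) 2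
  have key : ∀ z : R3, (l : ℝ≥0∞) ^ 3 * decayWeight ((l : ℝ) • (x - z)) *
      {z : R3 | |z 2 - ψ !₂[z 0, z 1]| ≤ c}.indicator 1 z ≤
      H (MeasurableEquiv.piFinSuccAbove (fun _ : Fin 3 ↦ ℝ) 2 (WithLp.ofLp z)) := by
    intro z
    have h0 : (MeasurableEquiv.piFinSuccAbove (fun _ : Fin 3 ↦ ℝ) 2 (WithLp.ofLp z)) =
        (z 2, ![z 0, z 1]) := by
      refine Prod.ext rfl ?_
      funext i
      fin_cases i <;> rfl
    rw [h0]
    simp only [H]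
    refine mul_le_mul' (mul_le_mul' le_rfl (decayWeight_le_of_norm_le ?_)) le_rfl
    rw [norm_smul, norm_smul]
    gcongr
    rw [pi_norm_le_iff_of_nonneg (norm_nonneg _)]
    intro i
    fin_cases i
    · exact PiLp.norm_apply_le (x - z) 0
    · exact PiLp.norm_apply_le (x - z) 1
  calc _ ≤ ∫⁻ z : R3, H (MeasurableEquiv.piFinSuccAbove (fun _ : Fin 3 ↦ ℝ) 2 (WithLp.ofLp z)) :=
        lintegral_mono key
    _ = ∫⁻ p, H p := by
        rw [e1.lintegral_comp
          (f := fun w ↦ H (MeasurableEquiv.piFinSuccAbove (fun _ : Fin 3 ↦ ℝ) 2 w))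
          (hH.comp (MeasurableEquiv.measurable _)), e2.lintegral_comp hH]
    _ = ∫⁻ w : Fin 2 → ℝ, ∫⁻ t : ℝ, H (t, w) := by
        rw [Measure.volume_eq_prod, lintegral_prod_symm' _ hH]
    _ = ∫⁻ w : Fin 2 → ℝ, (l : ℝ≥0∞) ^ 3 * decayWeight ((l : ℝ) • (x' - w)) * (2 * c) := by
        refine lintegral_congr fun w ↦ ?_
        simp only [H]
        rw [lintegral_const_mul' _ _ (hW w)]
        congr 1
        have : (fun t : ℝ ↦ S.indicator (1 : ℝ × (Fin 2 → ℝ) → ℝ≥0∞) (t, w)) =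
            (Set.Icc (ψ !₂[w 0, w 1] - c) (ψ !₂[w 0, w 1] + c)).indicator 1 := by
          funext t
          simp only [S, Set.indicator, Set.mem_ofPred_eq, Set.mem_Icc, abs_le, Pi.one_apply]
          congr 1
          apply propext
          constructor <;> rintro ⟨h1, h2⟩ <;> constructor <;> linarith
        rw [this, lintegral_indicator_one measurableSet_Icc, Real.volume_Icc]
        rw [show ψ !₂[w 0, w 1] + c - (ψ !₂[w 0, w 1] - c) = ((2 * c : ℝ≥0) : ℝ) by push_cast; ring,
          ENNReal.ofReal_coe_nnreal]
        push_cast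
        rfl
    _ = 2 * c * l * ∫⁻ w : Fin 2 → ℝ, (l : ℝ≥0∞) ^ 2 * decayWeight ((l : ℝ) • (x' - w)) := by
        rw [← lintegral_const_mul' _ _ (by finiteness)]
        refine lintegral_congr fun w ↦ ?_
        ring
    _ = 2 * c * l * ∫⁻ w : Fin 2 → ℝ, decayWeight w := by
        congr 1
        rw [lintegral_sub_left_eq_self
          (fun w : Fin 2 → ℝ ↦ (l : ℝ≥0∞) ^ 2 * decayWeight ((l : ℝ) • w)) x']
        simpa using lintegral_pow_mul_comp_smul (volume : Measure (Fin 2 → ℝ)) decayWeight hl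

/-- Two points at distance `‖h‖` on different sides of the graph of a `K`-Lipschitz function lie in
the strip of half-height `(1 + K) ‖h‖` around the graph. -/
theorem abs_sub_graph_le {ψ : EuclideanSpace ℝ (Fin 2) → ℝ} {K : ℝ≥0} (hψ : LipschitzWith K ψ)
    (y h : R3)
    (hyh : ¬ (y 2 < ψ !₂[y 0, y 1] ↔ (y - h) 2 < ψ !₂[(y - h) 0, (y - h) 1])) :
    |y 2 - ψ !₂[y 0, y 1]| ≤ (1 + K) * ‖h‖ := by
  have h2 : |h 2| ≤ ‖h‖ := PiLp.norm_apply_le h 2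
  have hd : |ψ !₂[y 0, y 1] - ψ !₂[(y - h) 0, (y - h) 1]| ≤ K * ‖h‖ := by
    have := hψ.dist_le_mul !₂[y 0, y 1] !₂[(y - h) 0, (y - h) 1]
    rw [Real.dist_eq] at this
    refine this.trans ?_
    gcongr
    rw [EuclideanSpace.dist_eq, EuclideanSpace.norm_eq]
    apply Real.sqrt_le_sqrt
    simp [Fin.sum_univ_succ, Real.dist_eq]
    positivity
  have e : (y - h) 2 = y 2 - h 2 := rfl
  rw [e] at hyh
  rw [abs_le] at *
  by_cases h1 : y 2 < ψ !₂[y 0, y 1]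
  · have h3 : ¬ (y 2 - h 2 < ψ !₂[(y - h) 0, (y - h) 1]) := fun h4 ↦ hyh ⟨fun _ ↦ h4, fun _ ↦ h1⟩
    constructor <;> nlinarith
  · have h3 : (y 2 - h 2 < ψ !₂[(y - h) 0, (y - h) 1]) := by
      by_contra h4
      exact hyh ⟨fun h5 ↦ absurd h5 h1, fun h5 ↦ absurd h5 h4⟩
    constructor <;> nlinarith

/-- A measurable bounded function has `A`-bounded variation at all scales at most one if its
translation moduli of continuity, in `L¹` with a weight of width `1 / l` and mass one, are
`A l ‖h‖`. For a characteristic function this says that the area of its boundary in a ball of radius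
`ρ ≤ 1` is `O(ρ²)`. The constant `A` bounds the function as well. -/
structure HasBVBound (A : ℝ≥0) (u : R3 → ℂ) : Prop where
  measurable : Measurable u
  enorm_le : ∀ y, ‖u y‖ₑ ≤ A
  lintegral_le : ∀ l : ℝ≥0, 1 ≤ l → ∀ x h : R3,
    ∫⁻ y, (l : ℝ≥0∞) ^ 3 * decayWeight ((l : ℝ) • (x - y)) * ‖u (y - h) - u y‖ₑ ≤
      A * l * ‖h‖ₑ

/-- The segment from a point of `P` to a point outside of `P` is connected, so it meets the
frontier. -/
theorem exists_mem_frontier_of_segment {P : Set R3} {y h : R3} (hyh : ¬ (y ∈ P ↔ y - h ∈ P)) :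
    ∃ z ∈ frontier P, dist y z ≤ ‖h‖ ∧ dist (y - h) z ≤ ‖h‖ := by
  have hc : IsPreconnected (segment ℝ y (y - h)) := (convex_segment _ _).isPreconnected
  have hn : (segment ℝ y (y - h) ∩ frontier P).Nonempty := by
    by_contra hne
    rw [Set.not_nonempty_iff_eq_empty, ← Set.disjoint_iff_inter_eq_empty] at hne
    have hin : ∀ z ∈ segment ℝ y (y - h), z ∈ P → z ∈ interior P := fun z hz hzP ↦ by
      by_contra hzi
      exact Set.disjoint_left.1 hne hz ⟨subset_closure hzP, hzi⟩
    have hout : ∀ z ∈ segment ℝ y (y - h), z ∉ P → z ∈ interior Pᶜ := fun z hz hzP ↦ by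
      by_contra hzi
      rw [← frontier_compl] at hne
      exact Set.disjoint_left.1 hne hz ⟨subset_closure hzP, hzi⟩
    have hcover : segment ℝ y (y - h) ⊆ interior P ∪ interior Pᶜ := fun z hz ↦
      (em (z ∈ P)).imp (hin z hz) (hout z hz)
    have hmeet : (segment ℝ y (y - h) ∩ (interior P ∩ interior Pᶜ)).Nonempty := by
      have h1 := left_mem_segment ℝ y (y - h)
      have h2 := right_mem_segment ℝ y (y - h)
      by_cases hy : y ∈ P
      · have hy' : y - h ∉ P := fun h' ↦ hyh ⟨fun _ ↦ h', fun _ ↦ hy⟩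
        exact hc _ _ isOpen_interior isOpen_interior hcover ⟨y, h1, hin _ h1 hy⟩
          ⟨y - h, h2, hout _ h2 hy'⟩
      · have hy' : y - h ∈ P := by
          by_contra h'
          exact hyh ⟨fun h3 ↦ absurd h3 hy, fun h3 ↦ absurd h3 h'⟩
        exact hc _ _ isOpen_interior isOpen_interior hcover ⟨y - h, h2, hin _ h2 hy'⟩
          ⟨y, h1, hout _ h1 hy⟩
    obtain ⟨z, -, hz1, hz2⟩ := hmeet
    exact interior_subset hz2 (interior_subset hz1)
  obtain ⟨z, hz, hzP⟩ := hn
  have hd : dist y (y - h) = ‖h‖ := by simp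
  have hm := dist_add_dist_of_mem_segment hz
  have h1 := dist_nonneg (x := y) (y := z)
  have h2 := dist_nonneg (x := z) (y := y - h)
  refine ⟨z, hzP, by linarith, ?_⟩
  rw [dist_comm]
  linarith

/-- Two points on different sides of the boundary that are closer than the Lebesgue number of a
finite cover of the boundary by charts lie in a common chart, hence in the strip around its graph.
For translations that are not small, the total mass of the weight is enough. -/
theorem IsBoundedLipschitzDomain.exists_hasBVBound_indicator {P : Set R3}
    (hP : IsBoundedLipschitzDomain P) :
    ∃ A : ℝ≥0, HasBVBound A (P.indicator 1) := by
  choose! e ψ K U hψ hU hUP using hP.lipschitz_boundary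
  have hcomp : IsCompact (frontier P) := by
    refine Metric.isCompact_of_isClosed_isBounded isClosed_frontier ?_
    exact hP.isBounded.closure.subset frontier_subset_closure
  obtain ⟨t, htP, htc⟩ := hcomp.elim_nhds_subcover (fun x ↦ interior (U x))
    (fun x hx ↦ interior_mem_nhds.2 (hU x hx))
  obtain ⟨δ, hδ, hball⟩ := lebesgue_number_lemma_of_metric (c := fun i : t ↦ interior (U i)) hcomp
    (fun _ ↦ isOpen_interior) (by simpa [Set.iUnion_subtype] using htc)
  have hmeas : Measurable (P.indicator (1 : R3 → ℂ)) :=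
    measurable_one.indicator hP.isOpen.measurableSet
  have hle1 : ∀ y, ‖P.indicator (1 : R3 → ℂ) y‖ₑ ≤ 1 := fun y ↦ by
    by_cases hy : y ∈ P <;> simp [hy]
  have hI2 : ∫⁻ w : Fin 2 → ℝ, decayWeight w ≠ ⊤ :=
    (lintegral_decayWeight_lt_top volume (by simp)).ne
  have hI3 : ∫⁻ w : R3, decayWeight w ≠ ⊤ :=
    (lintegral_decayWeight_lt_top volume (by simp)).ne
  lift ∫⁻ w : Fin 2 → ℝ, decayWeight w to ℝ≥0 using hI2 with J2 hJ2
  lift ∫⁻ w : R3, decayWeight w to ℝ≥0 using hI3 with J3 hJ3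
  have hvar : ∀ y h : R3, ‖P.indicator (1 : R3 → ℂ) (y - h) - P.indicator 1 y‖ₑ ≤ 2 := fun y h ↦
    (enorm_sub_le).trans ((add_le_add (hle1 _) (hle1 _)).trans_eq one_add_one_eq_two)
  let δ' : ℝ≥0 := ⟨δ, hδ.le⟩
  have hδ' : δ' ≠ 0 := by
    intro h0
    exact hδ.ne' (congrArg NNReal.toReal h0)
  let A1 : ℝ≥0 := 2 * J3 * δ'⁻¹
  let A2 : ℝ≥0 := ∑ i ∈ t, 2 * (1 + K i) * J2
  refine ⟨1 + A1 + A2, hmeas, fun y ↦ (hle1 y).trans ?_, fun l hl x h ↦ ?_⟩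
  · rw [← ENNReal.coe_one, ENNReal.coe_le_coe, add_assoc]
    exact le_self_add
  have hl0 : l ≠ 0 := (zero_lt_one.trans_le hl).ne'
  rcases le_or_gt δ ‖h‖ with hδh | hδh
  · -- large translations: the weight has mass `J3` and `l ‖h‖ ≥ δ`
    calc _ ≤ ∫⁻ y, (l : ℝ≥0∞) ^ 3 * decayWeight ((l : ℝ) • (x - y)) * 2 := by
          gcongr with y
          exact hvar y h
      _ = 2 * ∫⁻ y, (l : ℝ≥0∞) ^ 3 * decayWeight ((l : ℝ) • (x - y)) := by
          rw [lintegral_mul_const' _ _ (by finiteness), mul_comm]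
      _ = 2 * J3 := by
          rw [lintegral_sub_left_eq_self
            (fun y : R3 ↦ (l : ℝ≥0∞) ^ 3 * decayWeight ((l : ℝ) • y)) x,
            lintegral_pow_three_mul_comp_smul _ hl0, hJ3]
      _ = 2 * J3 * (δ'⁻¹ * δ' : ℝ≥0) * (1 : ℝ≥0) := by
          rw [inv_mul_cancel₀ hδ']
          simp
      _ = A1 * δ' * (1 : ℝ≥0) := by
          simp only [A1]
          push_cast
          ring
      _ ≤ A1 * ‖h‖ₑ * l := by
          gcongr
          rw [← ofReal_norm, ← ENNReal.ofReal_coe_nnreal]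
          exact ENNReal.ofReal_le_ofReal hδh
      _ = A1 * l * ‖h‖ₑ := by ring
      _ ≤ _ := by
          gcongr
          rw [add_comm 1 A1, add_assoc]
          exact le_self_add
  · have hpt : ∀ y, ‖P.indicator (1 : R3 → ℂ) (y - h) - P.indicator 1 y‖ₑ ≤
        ∑ i ∈ t, {z : R3 | |z 2 - ψ i !₂[z 0, z 1]| ≤ ((1 + K i) * ‖h‖₊ : ℝ≥0)}.indicator
          (1 : R3 → ℝ≥0∞) (e i y) := by
      intro y
      by_cases hyh : y ∈ P ↔ y - h ∈ P
      · have : P.indicator (1 : R3 → ℂ) (y - h) - P.indicator 1 y = 0 := by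
          by_cases hy : y ∈ P
          · simp [hy, hyh.1 hy]
          · have hy' : y - h ∉ P := fun h' ↦ hy (hyh.2 h')
            simp [hy, hy']
        simp [this]
      · obtain ⟨z, hz, hd1, hd2⟩ := exists_mem_frontier_of_segment hyh
        obtain ⟨⟨i, hi⟩, hzi⟩ := hball z hz
        have hyU : y ∈ U i := interior_subset (hzi (Metric.mem_ball.2 (hd1.trans_lt hδh)))
        have hyU' : y - h ∈ U i := interior_subset (hzi (Metric.mem_ball.2 (hd2.trans_lt hδh)))
        have hiP := htP i hi
        rw [hUP i hiP y hyU, hUP i hiP (y - h) hyU', map_sub] at hyh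
        have hs := abs_sub_graph_le (hψ i hiP) (e i y) (e i h) hyh
        rw [LinearIsometryEquiv.norm_map] at hs
        refine le_trans ?_ (Finset.single_le_sum (fun _ _ ↦ zero_le) hi)
        have hmem : e i y ∈ {z : R3 | |z 2 - ψ i !₂[z 0, z 1]| ≤ ((1 + K i) * ‖h‖₊ : ℝ≥0)} := by
          simpa using hs
        rw [Set.indicator_of_mem hmem]
        have h1 : ∀ a b : R3, ‖P.indicator (1 : R3 → ℂ) a - P.indicator 1 b‖ₑ ≤ 1 := by
          intro a b
          by_cases ha : a ∈ P <;> by_cases hb : b ∈ P <;> simp [ha, hb]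
        exact h1 _ _
    calc _ ≤ ∫⁻ y, ∑ i ∈ t, (l : ℝ≥0∞) ^ 3 * decayWeight ((l : ℝ) • (x - y)) *
            {z : R3 | |z 2 - ψ i !₂[z 0, z 1]| ≤ ((1 + K i) * ‖h‖₊ : ℝ≥0)}.indicator
              (1 : R3 → ℝ≥0∞) (e i y) := by
          simp_rw [← Finset.mul_sum]
          gcongr with y
          exact hpt y
      _ = ∑ i ∈ t, ∫⁻ y, (l : ℝ≥0∞) ^ 3 * decayWeight ((l : ℝ) • (x - y)) *
            {z : R3 | |z 2 - ψ i !₂[z 0, z 1]| ≤ ((1 + K i) * ‖h‖₊ : ℝ≥0)}.indicator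
              (1 : R3 → ℝ≥0∞) (e i y) := by
          refine lintegral_finsetSum _ fun i hi ↦ ?_
          refine Measurable.mul
            ((measurable_decayWeight.comp (by fun_prop)).const_mul _) ?_
          refine (measurable_one.indicator (IsClosed.measurableSet ?_)).comp
            (e i).continuous.measurable
          have hc := (hψ i (htP i hi)).continuous
          have : Continuous fun p : R3 ↦ (!₂[p 0, p 1] : EuclideanSpace ℝ (Fin 2)) := by
            fun_prop
          refine isClosed_le ?_ continuous_const
          fun_prop
      _ ≤ ∑ i ∈ t, 2 * (((1 + K i) * ‖h‖₊ : ℝ≥0) : ℝ≥0∞) * l * J2 := by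
          refine Finset.sum_le_sum fun i hi ↦ ?_
          rw [hJ2]
          refine le_trans (le_of_eq ?_)
            (lintegral_graph_strip_le (hψ i (htP i hi)).continuous _ hl0 (e i x))
          refine Eq.trans ?_ ((e i).measurePreserving.lintegral_comp_emb
            (e i).toHomeomorph.measurableEmbedding _)
          refine lintegral_congr fun y ↦ ?_
          congr 2
          unfold decayWeight
          rw [← map_sub, enorm_smul, enorm_smul, enorm_eq_nnnorm (e i (x - y)),
            LinearIsometryEquiv.nnnorm_map, ← enorm_eq_nnnorm]
      _ = A2 * l * ‖h‖ₑ := by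
          simp only [A2]
          push_cast
          rw [Finset.sum_mul, Finset.sum_mul]
          refine Finset.sum_congr rfl fun i _ ↦ ?_
          rw [enorm_eq_nnnorm]
          ring
      _ ≤ _ := by
          gcongr
          exact le_add_self

/-! ### Bumps -/

/-- The integral of the weight over `ℝ³`. -/
def weightMass : ℝ≥0 := (∫⁻ y : R3, decayWeight y).toNNReal

theorem coe_weightMass : (weightMass : ℝ≥0∞) = ∫⁻ y : R3, decayWeight y :=
  ENNReal.coe_toNNReal (lintegral_decayWeight_lt_top volume (by simp)).ne

theorem lintegral_scaled_decayWeight {l : ℝ≥0} (hl : l ≠ 0) (x : R3) :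
    ∫⁻ y, (l : ℝ≥0∞) ^ 3 * decayWeight ((l : ℝ) • (x - y)) = weightMass := by
  rw [lintegral_sub_left_eq_self (fun y : R3 ↦ (l : ℝ≥0∞) ^ 3 * decayWeight ((l : ℝ) • y)) x,
    lintegral_pow_three_mul_comp_smul _ hl, coe_weightMass]

/-- A bump of size `D`, width `1 / l` and center `x`: a function dominated by the weight of width
`1 / l` and mass one around `x`, whose translation modulus in `L¹` is that of a function with a
gradient of integral `D l`. -/
structure IsBump (D l : ℝ≥0) (x : R3) (g : R3 → ℂ) : Prop where
  measurable : Measurable g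
  enorm_le : ∀ y, ‖g y‖ₑ ≤ D * ((l : ℝ≥0∞) ^ 3 * decayWeight ((l : ℝ) • (x - y)))
  lintegral_translate_le : ∀ h, ∫⁻ y, ‖g (y - h) - g y‖ₑ ≤ D * l * ‖h‖ₑ

theorem IsBump.lintegral_enorm_le {D l : ℝ≥0} {x : R3} {g : R3 → ℂ} (hg : IsBump D l x g)
    (hl : l ≠ 0) : ∫⁻ y, ‖g y‖ₑ ≤ D * weightMass := by
  refine (lintegral_mono hg.enorm_le).trans_eq ?_
  rw [lintegral_const_mul' _ _ (by finiteness), lintegral_scaled_decayWeight hl]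

theorem HasBVBound.lintegral_enorm_mul_le {A D l : ℝ≥0} {x : R3} {u g : R3 → ℂ}
    (hu : HasBVBound A u) (hg : IsBump D l x g) (hl : l ≠ 0) :
    ∫⁻ y, ‖u y * g y‖ₑ ≤ A * (D * weightMass) := by
  simp_rw [enorm_mul]
  calc _ ≤ ∫⁻ y, A * ‖g y‖ₑ := by
        gcongr with y
        exact hu.enorm_le y
    _ = A * ∫⁻ y, ‖g y‖ₑ := lintegral_const_mul' _ _ (by finiteness)
    _ ≤ _ := by
        gcongr
        exact hg.lintegral_enorm_le hl

/-- The Leibniz rule for translation moduli. -/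
theorem HasBVBound.lintegral_translate_mul_le {A D l : ℝ≥0} {x : R3} {u g : R3 → ℂ}
    (hu : HasBVBound A u) (hg : IsBump D l x g) (hl : 1 ≤ l) (h : R3) :
    ∫⁻ y, ‖u (y - h) * g (y - h) - u y * g y‖ₑ ≤ 2 * A * D * l * ‖h‖ₑ := by
  have hpt : ∀ y, ‖u (y - h) * g (y - h) - u y * g y‖ₑ ≤ A * ‖g (y - h) - g y‖ₑ +
      D * ((l : ℝ≥0∞) ^ 3 * decayWeight ((l : ℝ) • (x - y)) * ‖u (y - h) - u y‖ₑ) := by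
    intro y
    have : u (y - h) * g (y - h) - u y * g y =
        u (y - h) * (g (y - h) - g y) + g y * (u (y - h) - u y) := by ring
    rw [this]
    refine (enorm_add_le _ _).trans ?_
    rw [enorm_mul, enorm_mul, ← mul_assoc (D : ℝ≥0∞)]
    gcongr
    · exact hu.enorm_le _
    · exact hg.enorm_le y
  refine (lintegral_mono hpt).trans ?_
  have hm : Measurable fun y ↦ (A : ℝ≥0∞) * ‖g (y - h) - g y‖ₑ := by
    have := hg.measurable
    fun_prop
  rw [lintegral_add_left hm, lintegral_const_mul' _ _ (by finiteness),
    lintegral_const_mul' _ _ (by finiteness)]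
  calc _ ≤ (A : ℝ≥0∞) * (D * l * ‖h‖ₑ) + D * (A * l * ‖h‖ₑ) := by
        gcongr
        · exact hg.lintegral_translate_le h
        · exact hu.lintegral_le l hl x h
    _ = _ := by ring

/-- The function `l³ k(l ·)`, of the same integral as `k`. -/
def dilate (l : ℝ≥0) (k : R3 → ℂ) (y : R3) : ℂ := (l : ℂ) ^ 3 * k ((l : ℝ) • y)

theorem enorm_dilate (l : ℝ≥0) (k : R3 → ℂ) (y : R3) :
    ‖dilate l k y‖ₑ = (l : ℝ≥0∞) ^ 3 * ‖k ((l : ℝ) • y)‖ₑ := by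
  have : ‖(l : ℂ)‖ₑ = l := by simp [enorm_eq_nnnorm]
  rw [dilate, enorm_mul, enorm_pow, this]

theorem measurable_dilate (l : ℝ≥0) {k : R3 → ℂ} (hk : Measurable k) :
    Measurable (dilate l k) := by
  unfold dilate
  fun_prop

theorem IsBump.dilate {D : ℝ≥0} {k : R3 → ℂ} (hk : IsBump D 1 0 k) {l : ℝ≥0} (hl : l ≠ 0)
    (x : R3) : IsBump D l x fun y ↦ dilate l k (x - y) where
  measurable := (measurable_dilate l hk.measurable).comp (by fun_prop)
  enorm_le y := by
    rw [enorm_dilate, mul_left_comm]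
    gcongr
    refine (hk.enorm_le _).trans_eq ?_
    simp [decayWeight]
  lintegral_translate_le h := by
    have e : ∀ y, ‖_root_.dilate l k (x - (y - h)) - _root_.dilate l k (x - y)‖ₑ =
        (fun z : R3 ↦ (l : ℝ≥0∞) ^ 3 *
          (fun w ↦ ‖k (w - -((l : ℝ) • h)) - k w‖ₑ) ((l : ℝ) • z)) (x - y) := by
      intro y
      have : ‖(l : ℂ)‖ₑ = l := by simp [enorm_eq_nnnorm]
      simp only [_root_.dilate]
      rw [← mul_sub, enorm_mul, enorm_pow, this, sub_neg_eq_add, ← smul_add, sub_sub_eq_add_sub,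
        add_sub_right_comm]
    rw [lintegral_congr e, lintegral_sub_left_eq_self (fun z : R3 ↦ (l : ℝ≥0∞) ^ 3 *
      (fun w ↦ ‖k (w - -((l : ℝ) • h)) - k w‖ₑ) ((l : ℝ) • z)), lintegral_pow_three_mul_comp_smul
      (fun w ↦ ‖k (w - -((l : ℝ) • h)) - k w‖ₑ) hl]
    refine (hk.lintegral_translate_le _).trans_eq ?_
    have : ‖(l : ℝ)‖ₑ = l := by simp [enorm_eq_nnnorm]
    rw [enorm_neg, enorm_smul, this]
    simp [mul_assoc]

/-- A seminorm that controls the size of a Schwartz function as a bump. -/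
def bumpSeminorm : Seminorm ℂ 𝓢(R3, ℂ) :=
  (Finset.Iic (4, 1)).sup (schwartzSeminormFamily ℂ R3 ℂ)

theorem enorm_iteratedFDeriv_le_bumpSeminorm (g : 𝓢(R3, ℂ)) {n : ℕ} (hn : n ≤ 1) (y : R3) :
    ‖iteratedFDeriv ℝ n g y‖ₑ ≤ (16 * (bumpSeminorm g).toNNReal : ℝ≥0) * decayWeight y := by
  have h := SchwartzMap.one_add_le_sup_seminorm_apply (𝕜 := ℂ) (m := (4, 1)) (k := 4) le_rfl hn g y
  change _ ≤ 2 ^ 4 * bumpSeminorm g at h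
  have hp := apply_nonneg bumpSeminorm g
  have hy : 0 < 1 + ‖y‖ := by positivity
  have h' : ‖iteratedFDeriv ℝ n g y‖ ≤ 16 * bumpSeminorm g * ((1 + ‖y‖) ^ 4)⁻¹ := by
    rw [← div_eq_mul_inv, le_div_iff₀ (by positivity)]
    linarith
  rw [decayWeight, ← ofReal_norm, ← ofReal_norm, ← ENNReal.ofReal_one,
    ← ENNReal.ofReal_add zero_le_one (norm_nonneg _), ← ENNReal.ofReal_pow hy.le,
    ← ENNReal.ofReal_inv_of_pos (by positivity), ← ENNReal.ofReal_coe_nnreal,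
    ← ENNReal.ofReal_mul (by positivity)]
  apply ENNReal.ofReal_le_ofReal
  rw [NNReal.coe_mul, Real.coe_toNNReal _ hp]
  exact h'

theorem decayWeight_le_of_dist_le_one {y z : R3} (h : ‖y - z‖ ≤ 1) :
    decayWeight z ≤ 16 * decayWeight y := by
  have h1 : 1 + ‖y‖ₑ ≤ 2 * (1 + ‖z‖ₑ) := by
    have : ‖y‖ₑ ≤ 1 + ‖z‖ₑ := by
      calc ‖y‖ₑ = ‖(y - z) + z‖ₑ := by simp
        _ ≤ ‖y - z‖ₑ + ‖z‖ₑ := enorm_add_le _ _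
        _ ≤ _ := by
          gcongr
          rw [← ofReal_norm, ← ENNReal.ofReal_one]
          exact ENNReal.ofReal_le_ofReal h
    calc 1 + ‖y‖ₑ ≤ 1 + (1 + ‖z‖ₑ) := by gcongr
      _ ≤ 1 + (1 + ‖z‖ₑ) + ‖z‖ₑ := le_self_add
      _ = _ := by ring
  have h2 : (1 + ‖y‖ₑ) ^ 4 ≤ 16 * (1 + ‖z‖ₑ) ^ 4 := by
    refine (pow_le_pow_left₀ zero_le h1 4).trans_eq ?_
    rw [mul_pow]
    norm_num
  unfold decayWeight
  rw [← ENNReal.div_eq_inv_mul.trans (mul_comm _ _), ENNReal.le_div_iff_mul_le (by simp) (by simp)]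
  rw [← ENNReal.div_eq_inv_mul, ENNReal.div_le_iff (by simp) (by finiteness)]
  exact h2

/-- Small translations are handled by the mean value inequality, large ones by the triangle
inequality. -/
theorem isBump_schwartz (g : 𝓢(R3, ℂ)) :
    IsBump (256 * (1 + weightMass) * (bumpSeminorm g).toNNReal) 1 0 g := by
  set p := (bumpSeminorm g).toNNReal
  have h0 : ∀ y, ‖g y‖ₑ ≤ (16 * p : ℝ≥0) * decayWeight y := fun y ↦ by
    have := enorm_iteratedFDeriv_le_bumpSeminorm g zero_le_one y
    rwa [← ofReal_norm, norm_iteratedFDeriv_zero, ofReal_norm] at this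
  have h1 : ∀ y, ‖fderiv ℝ g y‖ₑ ≤ (16 * p : ℝ≥0) * decayWeight y := fun y ↦ by
    have := enorm_iteratedFDeriv_le_bumpSeminorm g le_rfl y
    rwa [← ofReal_norm, norm_iteratedFDeriv_one, ofReal_norm] at this
  have hc : (16 * p : ℝ≥0) ≤ 256 * (1 + weightMass) * p := by
    rw [mul_assoc]
    gcongr
    · norm_num
    · exact le_mul_of_one_le_left' le_self_add
  refine ⟨g.continuous.measurable, fun y ↦ (h0 y).trans ?_, fun h ↦ ?_⟩
  · have : decayWeight (-y) = decayWeight y := by simp [decayWeight]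
    simp only [NNReal.coe_one, one_smul, zero_sub, this, ENNReal.coe_one, one_pow, one_mul]
    gcongr
  have hgm := g.continuous.measurable
  rcases le_or_gt ‖h‖ 1 with hh | hh
  · have hpt : ∀ y, ‖g (y - h) - g y‖ₑ ≤ (256 * p : ℝ≥0) * ‖h‖ₑ * decayWeight y := by
      intro y
      have hW : decayWeight y ≠ ⊤ := by
        rw [decayWeight_eq_ofReal]
        finiteness
      set B : ℝ≥0 := (256 * p) * (decayWeight y).toNNReal
      have hB : (B : ℝ≥0∞) = (256 * p : ℝ≥0) * decayWeight y := by
        simp only [B]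
        rw [ENNReal.coe_mul, ENNReal.coe_toNNReal hW]
      have hd : ∀ z ∈ Metric.closedBall y 1, ‖fderiv ℝ g z‖ ≤ B := by
        intro z hz
        have hz' : ‖y - z‖ ≤ 1 := by
          rw [← dist_eq_norm, dist_comm]
          exact hz
        have : ‖fderiv ℝ g z‖ₑ ≤ B := by
          refine (h1 z).trans ?_
          rw [hB]
          calc _ ≤ ((16 * p : ℝ≥0) : ℝ≥0∞) * (16 * decayWeight y) := by
                gcongr
                exact decayWeight_le_of_dist_le_one hz'
            _ = _ := by
                push_cast
                ring
        rw [enorm_eq_nnnorm, ENNReal.coe_le_coe] at this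
        exact this
      have := (convex_closedBall y 1).norm_image_sub_le_of_norm_fderiv_le (𝕜 := ℝ) (f := g)
        (fun z _ ↦ g.differentiableAt) hd (Metric.mem_closedBall_self zero_le_one)
        (show y - h ∈ Metric.closedBall y 1 by simpa [Metric.mem_closedBall, dist_eq_norm] using hh)
      have h3 : ‖g (y - h) - g y‖ₑ ≤ B * ‖h‖ₑ := by
        rw [enorm_eq_nnnorm, enorm_eq_nnnorm, ← ENNReal.coe_mul, ENNReal.coe_le_coe]
        have hs : ‖y - h - y‖ = ‖h‖ := by simp
        rw [hs] at this
        exact this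
      refine h3.trans_eq ?_
      rw [hB]
      ring
    refine (lintegral_mono hpt).trans ?_
    rw [lintegral_const_mul' _ _ (by finiteness), ← coe_weightMass]
    push_cast
    calc _ = (256 : ℝ≥0∞) * weightMass * p * 1 * ‖h‖ₑ := by ring
      _ ≤ _ := by
        gcongr
        exact le_add_self
  · have hW0 : ∫⁻ y, ‖g y‖ₑ ≤ (16 * p : ℝ≥0) * weightMass := by
      rw [coe_weightMass, ← lintegral_const_mul' _ _ (by finiteness)]
      exact lintegral_mono h0
    have hh' : 1 ≤ ‖h‖ₑ := by
      rw [← ofReal_norm, ← ENNReal.ofReal_one]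
      exact ENNReal.ofReal_le_ofReal hh.le
    calc ∫⁻ y, ‖g (y - h) - g y‖ₑ ≤ ∫⁻ y, (‖g (y - h)‖ₑ + ‖g y‖ₑ) :=
          lintegral_mono fun y ↦ enorm_sub_le
      _ = (∫⁻ y, ‖g y‖ₑ) + ∫⁻ y, ‖g y‖ₑ := by
          rw [lintegral_add_left (by fun_prop), lintegral_sub_right_eq_self (fun y ↦ ‖g y‖ₑ) h]
      _ ≤ (16 * p : ℝ≥0) * weightMass + (16 * p : ℝ≥0) * weightMass := by gcongr
      _ = 32 * weightMass * p * 1 := by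
          push_cast
          ring
      _ ≤ 256 * (1 + weightMass) * p * ‖h‖ₑ := by
          gcongr
          · norm_num
          · exact le_add_self
      _ = _ := by
          push_cast
          ring

/-! ### Convolution with integrable kernels -/

/-- The convolution `k * u`. -/
def conv (k u : R3 → ℂ) (x : R3) : ℂ := ∫ t, k t * u (x - t)

/-- An integrable kernel of `L¹` norm at most `N` and first absolute moment at most `N₁`. -/
structure IsKernel (N N₁ : ℝ≥0) (k : R3 → ℂ) : Prop where
  measurable : Measurable k
  lintegral_le : ∫⁻ t, ‖k t‖ₑ ≤ N
  moment_le : ∫⁻ t, ‖k t‖ₑ * ‖t‖ₑ ≤ N₁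

theorem IsKernel.integrable {N N₁ : ℝ≥0} {k : R3 → ℂ} (hk : IsKernel N N₁ k) : Integrable k :=
  ⟨hk.measurable.aestronglyMeasurable, hk.lintegral_le.trans_lt ENNReal.coe_lt_top⟩

theorem IsKernel.dilate {N N₁ : ℝ≥0} {k : R3 → ℂ} (hk : IsKernel N N₁ k) {l : ℝ≥0} (hl : l ≠ 0) :
    IsKernel N (l⁻¹ * N₁) (dilate l k) where
  measurable := measurable_dilate l hk.measurable
  lintegral_le := by
    simp_rw [enorm_dilate]
    rw [lintegral_pow_three_mul_comp_smul (fun y ↦ ‖k y‖ₑ) hl]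
    exact hk.lintegral_le
  moment_le := by
    have hl' : (l : ℝ≥0∞) ≠ 0 := by exact_mod_cast hl
    have e : ∀ t, ‖_root_.dilate l k t‖ₑ * ‖t‖ₑ = (l : ℝ≥0∞)⁻¹ *
        ((l : ℝ≥0∞) ^ 3 * (fun y : R3 ↦ ‖k y‖ₑ * ‖y‖ₑ) ((l : ℝ) • t)) := by
      intro t
      have h1 : ‖(l : ℝ)‖ₑ = l := by simp [enorm_eq_nnnorm]
      rw [enorm_dilate]
      simp only [enorm_smul, h1]
      calc _ = ((l : ℝ≥0∞)⁻¹ * l) * ((l : ℝ≥0∞) ^ 3 * ‖k ((l : ℝ) • t)‖ₑ * ‖t‖ₑ) := by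
            rw [ENNReal.inv_mul_cancel hl' (by finiteness), one_mul]
        _ = _ := by ring
    rw [lintegral_congr e, lintegral_const_mul' _ _ (by finiteness),
      lintegral_pow_three_mul_comp_smul (fun y : R3 ↦ ‖k y‖ₑ * ‖y‖ₑ) hl, ENNReal.coe_mul,
      ENNReal.coe_inv hl]
    gcongr
    exact hk.moment_le

theorem integral_dilate {l : ℝ≥0} (hl : l ≠ 0) (k : R3 → ℂ) : ∫ t, dilate l k t = ∫ t, k t := by
  have hl' : (l : ℂ) ^ 3 ≠ 0 := pow_ne_zero _ (by exact_mod_cast hl)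
  unfold dilate
  rw [integral_const_mul, Measure.integral_comp_smul]
  simp only [finrank_euclideanSpace, Fintype.card_fin]
  rw [abs_of_nonneg (by positivity), Complex.real_smul, ← mul_assoc]
  push_cast
  rw [mul_inv_cancel₀ hl', one_mul]

theorem exists_isKernel_schwartz (k : 𝓢(R3, ℂ)) : ∃ N N₁, IsKernel N N₁ k := by
  have h0 : ∫⁻ t, ‖k t‖ₑ ≠ ⊤ := k.integrable.2.ne
  have h1 : ∫⁻ t, ‖k t‖ₑ * ‖t‖ₑ ≠ ⊤ := by
    have h := (k.integrable_pow_mul volume 1).2.ne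
    convert h using 3 with t
    simp only [pow_one, enorm_mul, enorm_norm, mul_comm]
  exact ⟨(∫⁻ t, ‖k t‖ₑ).toNNReal, (∫⁻ t, ‖k t‖ₑ * ‖t‖ₑ).toNNReal, k.continuous.measurable,
    (ENNReal.coe_toNNReal h0).ge, (ENNReal.coe_toNNReal h1).ge⟩

section conv

variable {N N₁ A : ℝ≥0} {k u : R3 → ℂ}

theorem IsKernel.integrable_mul_comp_sub (hk : IsKernel N N₁ k) (hu : Measurable u)
    (hA : ∀ y, ‖u y‖ₑ ≤ A) (x : R3) : Integrable fun t ↦ k t * u (x - t) := by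
  refine hk.integrable.mul_bdd (c := (A : ℝ)) (hu.comp (by fun_prop)).aestronglyMeasurable ?_
  refine Eventually.of_forall fun t ↦ ?_
  have := hA (x - t)
  rwa [enorm_eq_nnnorm, ENNReal.coe_le_coe] at this

theorem measurable_conv (hk : Measurable k) (hu : Measurable u) : Measurable (conv k u) := by
  have : StronglyMeasurable (Function.uncurry fun x t : R3 ↦ k t * u (x - t)) := by
    apply Measurable.stronglyMeasurable
    unfold Function.uncurry
    fun_prop
  exact this.integral_prod_right.measurable

theorem IsKernel.enorm_conv_le (hk : IsKernel N N₁ k) (hA : ∀ y, ‖u y‖ₑ ≤ A) (x : R3) :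
    ‖conv k u x‖ₑ ≤ N * A := by
  calc ‖conv k u x‖ₑ ≤ ∫⁻ t, ‖k t * u (x - t)‖ₑ := enorm_integral_le_lintegral_enorm _
    _ ≤ ∫⁻ t, ‖k t‖ₑ * A := by
        gcongr with t
        rw [enorm_mul]
        gcongr
        exact hA _
    _ = (∫⁻ t, ‖k t‖ₑ) * A := lintegral_mul_const' _ _ (by finiteness)
    _ ≤ _ := by
        gcongr
        exact hk.lintegral_le

/-- The bound of the variation at all scales is invariant under translations, hence under averages
of translations. -/
theorem HasBVBound.conv (hu : HasBVBound A u) (hk : IsKernel N N₁ k) :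
    HasBVBound (N * A) (conv k u) where
  measurable := measurable_conv hk.measurable hu.measurable
  enorm_le y := by
    rw [ENNReal.coe_mul]
    exact hk.enorm_conv_le hu.enorm_le y
  lintegral_le l hl x h := by
    have hkm := hk.measurable
    have hum := hu.measurable
    have hW := measurable_decayWeight (E := R3)
    set w : R3 → R3 → ℝ≥0∞ := fun x y ↦ (l : ℝ≥0∞) ^ 3 * decayWeight ((l : ℝ) • (x - y)) with hw
    have hwm : ∀ x, Measurable (w x) := fun x ↦ by
      simp only [hw]
      fun_prop
    have hpt : ∀ y, ‖_root_.conv k u (y - h) - _root_.conv k u y‖ₑ ≤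
        ∫⁻ t, ‖k t‖ₑ * ‖u (y - t - h) - u (y - t)‖ₑ := by
      intro y
      have e : _root_.conv k u (y - h) - _root_.conv k u y =
          ∫ t, k t * (u (y - t - h) - u (y - t)) := by
        unfold _root_.conv
        rw [← integral_sub (hk.integrable_mul_comp_sub hum hu.enorm_le _)
          (hk.integrable_mul_comp_sub hum hu.enorm_le _)]
        congr 1
        funext t
        rw [sub_right_comm y h t, mul_sub]
      rw [e]
      refine (enorm_integral_le_lintegral_enorm _).trans_eq ?_
      simp_rw [enorm_mul]
    calc ∫⁻ y, w x y * ‖_root_.conv k u (y - h) - _root_.conv k u y‖ₑ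
        ≤ ∫⁻ y, w x y * ∫⁻ t, ‖k t‖ₑ * ‖u (y - t - h) - u (y - t)‖ₑ := by
          gcongr with y
          exact hpt y
      _ = ∫⁻ y, ∫⁻ t, w x y * (‖k t‖ₑ * ‖u (y - t - h) - u (y - t)‖ₑ) := by
          refine lintegral_congr fun y ↦ ?_
          rw [lintegral_const_mul _ (by fun_prop)]
      _ = ∫⁻ t, ∫⁻ y, w x y * (‖k t‖ₑ * ‖u (y - t - h) - u (y - t)‖ₑ) := by
          apply lintegral_lintegral_swap
          have := hwm x
          unfold Function.uncurry
          fun_prop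
      _ = ∫⁻ t, ‖k t‖ₑ * ∫⁻ y, w (x - t) y * ‖u (y - h) - u y‖ₑ := by
          refine lintegral_congr fun t ↦ ?_
          rw [← lintegral_sub_right_eq_self (fun y ↦ w (x - t) y * ‖u (y - h) - u y‖ₑ) t,
            ← lintegral_const_mul' _ _ (by finiteness)]
          refine lintegral_congr fun y ↦ ?_
          simp only [hw]
          rw [sub_sub_sub_cancel_right]
          ring
      _ ≤ ∫⁻ t, ‖k t‖ₑ * (A * l * ‖h‖ₑ) := by
          gcongr with t
          exact hu.lintegral_le l hl (x - t) h
      _ = (∫⁻ t, ‖k t‖ₑ) * (A * l * ‖h‖ₑ) := lintegral_mul_const' _ _ (by finiteness)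
      _ ≤ N * (A * l * ‖h‖ₑ) := by
          gcongr
          exact hk.lintegral_le
      _ = _ := by
          push_cast
          ring

/-- Averages of a function of bounded variation over translations of length `N₁` are `O(N₁)` close
to the function in weighted `L¹`. -/
theorem HasBVBound.lintegral_conv_sub_mul_le (hu : HasBVBound A u) (hk : IsKernel N N₁ k)
    (hk1 : ∫ t, k t = 1) {D : ℝ≥0} {x : R3} {g : R3 → ℂ} (hg : IsBump D 1 x g) :
    ∫⁻ y, ‖(_root_.conv k u y - u y) * g y‖ₑ ≤ N₁ * A * D := by
  have hkm := hk.measurable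
  have hum := hu.measurable
  have hgm := hg.measurable
  have hpt : ∀ y, ‖_root_.conv k u y - u y‖ₑ ≤ ∫⁻ t, ‖k t‖ₑ * ‖u (y - t) - u y‖ₑ := by
    intro y
    have e : _root_.conv k u y - u y = ∫ t, k t * (u (y - t) - u y) := by
      simp_rw [mul_sub]
      rw [integral_sub (hk.integrable_mul_comp_sub hum hu.enorm_le _)
        (hk.integrable.mul_const _), integral_mul_const, hk1, one_mul]
      rfl
    rw [e]
    refine (enorm_integral_le_lintegral_enorm _).trans_eq ?_
    simp_rw [enorm_mul]
  calc ∫⁻ y, ‖(_root_.conv k u y - u y) * g y‖ₑ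
      ≤ ∫⁻ y, (∫⁻ t, ‖k t‖ₑ * ‖u (y - t) - u y‖ₑ) * ‖g y‖ₑ := by
        simp_rw [enorm_mul]
        gcongr with y
        exact hpt y
    _ = ∫⁻ y, ∫⁻ t, ‖k t‖ₑ * ‖u (y - t) - u y‖ₑ * ‖g y‖ₑ := by
        refine lintegral_congr fun y ↦ ?_
        rw [lintegral_mul_const' _ _ (by finiteness)]
    _ = ∫⁻ t, ∫⁻ y, ‖k t‖ₑ * ‖u (y - t) - u y‖ₑ * ‖g y‖ₑ := by
        apply lintegral_lintegral_swap
        unfold Function.uncurry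
        fun_prop
    _ ≤ ∫⁻ t, ‖k t‖ₑ * (D * (A * ‖t‖ₑ)) := by
        gcongr with t
        simp_rw [mul_assoc]
        rw [lintegral_const_mul' _ _ (by finiteness)]
        gcongr
        have h1 := hu.lintegral_le 1 le_rfl x t
        rw [ENNReal.coe_one, mul_one] at h1
        refine le_trans ?_ (mul_le_mul_right h1 _)
        rw [← lintegral_const_mul' _ _ (by finiteness)]
        refine lintegral_mono fun y ↦ ?_
        have := hg.enorm_le y
        rw [ENNReal.coe_one] at this
        calc _ ≤ ‖u (y - t) - u y‖ₑ * _ := mul_le_mul' le_rfl this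
          _ = _ := by ring
    _ = (D * A) * ∫⁻ t, ‖k t‖ₑ * ‖t‖ₑ := by
        rw [← lintegral_const_mul' _ _ (by finiteness)]
        refine lintegral_congr fun t ↦ ?_
        ring
    _ ≤ (D * A) * N₁ := by
        gcongr
        exact hk.moment_le
    _ = _ := by ring

/-- A bounded function `f = k * f`, with a kernel `k` of mean zero, sees only the oscillations of
`G`. -/
theorem IsKernel.enorm_integral_mul_le (hk : IsKernel N N₁ k) (hk0 : ∫ t, k t = 0) {f G : R3 → ℂ}
    (hf : Measurable f) (hA : ∀ y, ‖f y‖ₑ ≤ A) (hfk : f =ᵐ[volume] _root_.conv k f)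
    (hG : Measurable G) (hGi : ∫⁻ y, ‖G y‖ₑ < ⊤) {B : ℝ≥0∞} (hB : B ≠ ⊤)
    (hGB : ∀ h, ∫⁻ y, ‖G (y - h) - G y‖ₑ ≤ B * ‖h‖ₑ) :
    ‖∫ y, G y * f y‖ₑ ≤ N₁ * A * B := by
  have hkm := hk.measurable
  have hGint : Integrable G := ⟨hG.aestronglyMeasurable, hGi⟩
  have hA' : ∀ y, ‖f y‖ ≤ A := fun y ↦ by
    have := hA y
    rwa [enorm_eq_nnnorm, ENNReal.coe_le_coe] at this
  have hprod : Integrable (Function.uncurry fun y t : R3 ↦ G y * (k t * f (y - t)))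
      (volume.prod volume) := by
    have h1 : Integrable (fun p : R3 × R3 ↦ G p.1 * k p.2) (volume.prod volume) :=
      hGint.mul_prod hk.integrable
    have h2 := h1.mul_bdd (c := (A : ℝ)) (g := fun p : R3 × R3 ↦ f (p.1 - p.2))
      (hf.comp (measurable_fst.sub measurable_snd)).aestronglyMeasurable
      (Eventually.of_forall fun p ↦ hA' _)
    convert h2 using 2 with p
    simp only [Function.uncurry]
    ring
  have hGf : ∀ h, Integrable fun y ↦ f y * G (y + h) := fun h ↦
    (hGint.comp_add_right h).bdd_mul hf.aestronglyMeasurable (Eventually.of_forall hA')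
  have hswap : ∀ t, ∫ y, G y * (k t * f (y - t)) = k t * ∫ y, f y * G (y + t) := fun t ↦ by
    rw [← integral_sub_right_eq_self (fun y ↦ f y * G (y + t)) t, ← integral_const_mul]
    congr 1
    funext y
    rw [sub_add_cancel]
    ring
  have hint : Integrable fun t ↦ k t * ∫ y, f y * G (y + t) := by
    have := hprod.integral_prod_right
    simpa only [Function.uncurry, hswap] using this
  have e1 : ∫ y, G y * f y = ∫ t, k t * ∫ y, f y * (G (y + t) - G y) := by
    calc ∫ y, G y * f y = ∫ y, ∫ t, G y * (k t * f (y - t)) := by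
          refine integral_congr_ae ?_
          filter_upwards [hfk] with y hy
          rw [integral_const_mul, hy]
          rfl
      _ = ∫ t, ∫ y, G y * (k t * f (y - t)) := integral_integral_swap hprod
      _ = ∫ t, k t * ∫ y, f y * G (y + t) := by simp_rw [hswap]
      _ = (∫ t, k t * ∫ y, f y * G (y + t)) - ∫ t, k t * ∫ y, f y * G y := by
          rw [integral_mul_const, hk0, zero_mul, sub_zero]
      _ = ∫ t, (k t * (∫ y, f y * G (y + t)) - k t * ∫ y, f y * G y) :=
          (integral_sub hint (hk.integrable.mul_const _)).symm
      _ = _ := by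
          congr 1
          funext t
          have h0 : Integrable fun y ↦ f y * G y := by simpa using hGf 0
          simp_rw [mul_sub]
          rw [integral_sub (hGf t) h0, mul_sub]
  rw [e1]
  calc _ ≤ ∫⁻ t, ‖k t * ∫ y, f y * (G (y + t) - G y)‖ₑ := enorm_integral_le_lintegral_enorm _
    _ ≤ ∫⁻ t, ‖k t‖ₑ * (A * (B * ‖t‖ₑ)) := by
        gcongr with t
        rw [enorm_mul]
        gcongr
        refine (enorm_integral_le_lintegral_enorm _).trans ?_
        simp_rw [enorm_mul]
        calc _ ≤ ∫⁻ y, A * ‖G (y + t) - G y‖ₑ := by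
              gcongr with y
              exact hA y
          _ = A * ∫⁻ y, ‖G (y - -t) - G y‖ₑ := by
              rw [lintegral_const_mul' _ _ (by finiteness)]
              simp_rw [sub_neg_eq_add]
          _ ≤ _ := by
              gcongr
              simpa using hGB (-t)
    _ = (A * B) * ∫⁻ t, ‖k t‖ₑ * ‖t‖ₑ := by
        rw [← lintegral_const_mul' _ _ (by finiteness)]
        refine lintegral_congr fun t ↦ ?_
        ring
    _ ≤ (A * B) * N₁ := by
        gcongr
        exact hk.moment_le
    _ = _ := by ring

end conv

/-! ### Distributions represented by bounded functions -/

/-- The distribution `f` is integration against the measurable function `F`, which is bounded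
everywhere by `A`. -/
structure IsRepresentedBy (f : 𝓢'(R3, ℂ)) (F : R3 → ℂ) (A : ℝ≥0) : Prop where
  measurable : Measurable F
  enorm_le : ∀ y, ‖F y‖ₑ ≤ A
  apply_eq : ∀ g : 𝓢(R3, ℂ), f g = ∫ x, g x * F x

theorem memLp_top_of_enorm_le {F : R3 → ℂ} {A : ℝ≥0} (hF : Measurable F) (hA : ∀ y, ‖F y‖ₑ ≤ A) :
    MemLp F ∞ (volume : Measure R3) :=
  memLp_top_of_bound hF.aestronglyMeasurable A <| Eventually.of_forall fun y ↦ by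
    have := hA y
    rwa [enorm_eq_nnnorm, ENNReal.coe_le_coe] at this

theorem exists_isRepresentedBy {F : R3 → ℂ} {A : ℝ≥0} (hF : Measurable F)
    (hA : ∀ y, ‖F y‖ₑ ≤ A) : ∃ f, IsRepresentedBy f F A := by
  have h := memLp_top_of_enorm_le hF hA
  refine ⟨Lp.toTemperedDistribution (h.toLp F), hF, hA, fun g ↦ ?_⟩
  rw [Lp.toTemperedDistribution_apply]
  refine integral_congr_ae ?_
  filter_upwards [h.coeFn_toLp] with x hx
  rw [hx, smul_eq_mul]

theorem IsRepresentedBy.eq_toTemperedDistribution {f : 𝓢'(R3, ℂ)} {F : R3 → ℂ} {A : ℝ≥0}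
    (h : IsRepresentedBy f F A) :
    Lp.toTemperedDistribution ((memLp_top_of_enorm_le h.measurable h.enorm_le).toLp F) = f := by
  ext g
  rw [Lp.toTemperedDistribution_apply, h.apply_eq]
  refine integral_congr_ae ?_
  filter_upwards [(memLp_top_of_enorm_le h.measurable h.enorm_le).coeFn_toLp] with x hx
  rw [hx, smul_eq_mul]

theorem IsRepresentedBy.linftyNorm_le {f : 𝓢'(R3, ℂ)} {F : R3 → ℂ} {A : ℝ≥0}
    (h : IsRepresentedBy f F A) : linftyNorm f ≤ A := by
  have hle : linftyNorm f ≤ ‖(memLp_top_of_enorm_le h.measurable h.enorm_le).toLp F‖ₑ :=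
    iInf₂_le ((memLp_top_of_enorm_le h.measurable h.enorm_le).toLp F) h.eq_toTemperedDistribution
  refine hle.trans ?_
  rw [Lp.enorm_toLp, eLpNorm_exponent_top]
  exact eLpNormEssSup_le_of_ae_enorm_bound (Eventually.of_forall h.enorm_le)

theorem injective_toTemperedDistribution :
    Function.Injective (Lp.toTemperedDistribution : Lp ℂ ∞ (volume : Measure R3) → 𝓢'(R3, ℂ)) := by
  have := Lp.ker_toTemperedDistributionCLM_eq_bot (F := ℂ) (μ := (volume : Measure R3)) (p := ∞)
  rw [LinearMap.ker_eq_bot] at this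
  exact this

theorem IsRepresentedBy.ae_eq {f : 𝓢'(R3, ℂ)} {F F' : R3 → ℂ} {A A' : ℝ≥0}
    (h : IsRepresentedBy f F A) (h' : IsRepresentedBy f F' A') : F =ᵐ[volume] F' := by
  have := injective_toTemperedDistribution
    (h.eq_toTemperedDistribution.trans h'.eq_toTemperedDistribution.symm)
  rwa [MemLp.toLp_eq_toLp_iff] at this

theorem exists_isRepresentedBy_of_linftyNorm {f : 𝓢'(R3, ℂ)} (hf : linftyNorm f ≠ ⊤) :
    ∃ F, IsRepresentedBy f F (linftyNorm f).toNNReal := by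
  obtain ⟨G, hG⟩ : ∃ G : Lp ℂ ∞ (volume : Measure R3), Lp.toTemperedDistribution G = f := by
    by_contra! hne
    exact hf (by simp [linftyNorm, hne])
  have hn : linftyNorm f = ‖G‖ₑ := by
    unfold linftyNorm
    refine le_antisymm (iInf₂_le G hG) (le_iInf₂ fun G' hG' ↦ ?_)
    rw [injective_toTemperedDistribution (hG'.trans hG.symm)]
  have hGm := (Lp.stronglyMeasurable G).measurable
  have hae : ∀ᵐ x, ‖G x‖ₑ ≤ ‖G‖ₑ := by
    rw [Lp.enorm_def, eLpNorm_exponent_top]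
    exact ae_le_eLpNormEssSup
  have hs : MeasurableSet {x | ‖G x‖ₑ ≤ ‖G‖ₑ} := measurableSet_le hGm.enorm measurable_const
  refine ⟨{x | ‖G x‖ₑ ≤ ‖G‖ₑ}.indicator G, hGm.indicator hs, fun y ↦ ?_, fun g ↦ ?_⟩
  · rw [ENNReal.coe_toNNReal hf, hn]
    by_cases hy : y ∈ {x | ‖G x‖ₑ ≤ ‖G‖ₑ}
    · rw [Set.indicator_of_mem hy]
      exact hy
    · rw [Set.indicator_of_notMem hy]
      simp
  · rw [← hG, Lp.toTemperedDistribution_apply]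
    refine integral_congr_ae ?_
    filter_upwards [hae] with x hx
    rw [Set.indicator_of_mem (show x ∈ {x | ‖G x‖ₑ ≤ ‖G‖ₑ} from hx), smul_eq_mul]

/-- An absolutely convergent series of bounded functions represents the sum of the series of
distributions. -/
theorem isRepresentedBy_tsum {f : 𝓢'(R3, ℂ)} {fn : ℕ → 𝓢'(R3, ℂ)} {F : ℕ → R3 → ℂ} {a : ℕ → ℝ≥0}
    (hF : ∀ n, IsRepresentedBy (fn n) (F n) (a n)) (ha : Summable a)
    (hf : ∀ g, HasSum (fun n ↦ fn n g) (f g)) :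
    IsRepresentedBy f (fun x ↦ ∑' n, F n x) (∑' n, a n) := by
  have hle : ∀ n x, ‖F n x‖ ≤ a n := fun n x ↦ by
    have := (hF n).enorm_le x
    rwa [enorm_eq_nnnorm, ENNReal.coe_le_coe] at this
  have ha' : Summable fun n ↦ (a n : ℝ) := NNReal.summable_coe.2 ha
  have hs : ∀ x, Summable fun n ↦ F n x := fun x ↦ .of_norm_bounded ha' fun n ↦ hle n x
  refine ⟨?_, fun x ↦ ?_, fun g ↦ ?_⟩
  · refine measurable_of_tendsto_metrizable (f := fun n x ↦ ∑ i ∈ Finset.range n, F i x)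
      (fun n ↦ Finset.measurable_fun_sum _ fun i _ ↦ (hF i).measurable) ?_
    rw [tendsto_pi_nhds]
    exact fun x ↦ (hs x).hasSum.tendsto_sum_nat
  · rw [enorm_eq_nnnorm, ENNReal.coe_le_coe, ← NNReal.coe_le_coe, coe_nnnorm, NNReal.coe_tsum]
    exact tsum_of_norm_bounded ha'.hasSum fun n ↦ hle n x
  · have hint : ∀ n, Integrable fun x ↦ g x * F n x := fun n ↦
      g.integrable.mul_bdd (hF n).measurable.aestronglyMeasurable
        (Eventually.of_forall (hle n))
    have h1 : Summable fun n ↦ ∫ x, ‖g x * F n x‖ := by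
      refine .of_nonneg_of_le (fun n ↦ by positivity) (fun n ↦ ?_)
        (ha'.mul_left (∫ x, ‖g x‖))
      rw [← integral_mul_const]
      refine integral_mono (hint n).norm (g.integrable.norm.mul_const _) fun x ↦ ?_
      simp only [norm_mul]
      gcongr
      exact hle n x
    have h2 := hasSum_integral_of_summable_integral_norm hint h1
    have h3 : ∀ n, ∫ x, g x * F n x = fn n g := fun n ↦ ((hF n).apply_eq g).symm
    simp_rw [h3] at h2
    rw [(hf g).unique h2]
    congr 1
    funext x
    rw [tsum_mul_left]

/-! ### Fourier multipliers -/

/-- The convolution kernel of the Fourier multiplier with symbol `σ`. -/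
abbrev kernel (σ : 𝓢(R3, ℂ)) : 𝓢(R3, ℂ) := 𝓕⁻ σ

/-- The rescaling of a symbol rescales the kernel. -/
theorem exists_schwartz_scaled (σ : 𝓢(R3, ℂ)) {l : ℝ≥0} (hl : l ≠ 0) :
    ∃ τ : 𝓢(R3, ℂ), (∀ ξ, τ ξ = σ ((l : ℝ)⁻¹ • ξ)) ∧ ∀ x, kernel τ x = dilate l (kernel σ) x := by
  have hl' : (l : ℝ) ≠ 0 := by exact_mod_cast hl
  let e : R3 ≃L[ℝ] R3 :=
    (LinearEquiv.smulOfNeZero ℝ R3 (l : ℝ)⁻¹ (inv_ne_zero hl')).toContinuousLinearEquiv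
  refine ⟨SchwartzMap.compCLMOfContinuousLinearEquiv ℂ e σ, fun ξ ↦ rfl, fun x ↦ ?_⟩
  rw [dilate, SchwartzMap.fourierInv_coe, SchwartzMap.fourierInv_coe, Real.fourierInv_eq,
    Real.fourierInv_eq]
  have h : ∀ v : R3, Real.fourierChar (inner ℝ v x) •
      (SchwartzMap.compCLMOfContinuousLinearEquiv ℂ e σ) v =
      (fun w : R3 ↦ Real.fourierChar (inner ℝ w ((l : ℝ) • x)) • σ w) ((l : ℝ)⁻¹ • v) := by
    intro v
    simp only [inner_smul_left, inner_smul_right]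
    have : (starRingEnd ℝ) (l : ℝ)⁻¹ * ((l : ℝ) * inner ℝ v x) = inner ℝ v x := by
      simp [hl']
    rw [mul_left_comm, this]
    rfl
  rw [integral_congr_ae (Eventually.of_forall h), Measure.integral_comp_smul volume
    (fun w : R3 ↦ Real.fourierChar (inner ℝ w ((l : ℝ) • x)) • σ w)]
  simp only [finrank_euclideanSpace, Fintype.card_fin]
  rw [abs_of_nonneg (by positivity), inv_pow, inv_inv, Complex.real_smul]
  push_cast
  rfl

/-- The transpose of a Fourier multiplier on Schwartz functions, as an average of translations. -/
theorem fourier_mul_fourierInv_apply (τ u : 𝓢(R3, ℂ)) (y : R3) :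
    𝓕 (SchwartzMap.smulLeftCLM ℂ τ (𝓕⁻ u)) y = ∫ t, kernel τ t * u (y + t) := by
  have hg : Integrable fun ξ : R3 ↦ Real.fourierChar (-inner ℝ ξ y) • τ ξ :=
    (Real.fourierIntegral_convergent_iff y).2 (τ.integrable (μ := volume))
  have key := VectorFourier.integral_fourierIntegral_smul_eq_flip (L := -innerₗ R3)
    Real.continuous_fourierChar (continuous_inner.neg) (u.integrable (μ := volume)) hg
  have hflip : (-innerₗ R3).flip = -innerₗ R3 := by
    ext a b
    simp [real_inner_comm]
  rw [hflip] at key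
  have h1 : 𝓕 (SchwartzMap.smulLeftCLM ℂ τ (𝓕⁻ u)) y =
      ∫ ξ, 𝓕⁻ u ξ • (Real.fourierChar (-inner ℝ ξ y) • τ ξ) := by
    rw [SchwartzMap.fourier_coe, Real.fourier_eq]
    congr 1
    funext ξ
    rw [SchwartzMap.smulLeftCLM_apply_apply τ.hasTemperateGrowth]
    simp only [Circle.smul_def, smul_eq_mul]
    ring
  have h2 : ∀ x, VectorFourier.fourierIntegral Real.fourierChar volume (-innerₗ R3)
      (fun ξ : R3 ↦ Real.fourierChar (-inner ℝ ξ y) • τ ξ) x = kernel τ (x - y) := by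
    intro x
    rw [SchwartzMap.fourierInv_coe, Real.fourierInv_eq, VectorFourier.fourierIntegral]
    congr 1
    funext ξ
    simp only [Circle.smul_def, smul_eq_mul, LinearMap.neg_apply, innerₗ_apply_apply, neg_neg]
    rw [← mul_assoc, ← Circle.coe_mul, ← AddChar.map_add_eq_mul, inner_sub_right, sub_eq_add_neg]
  simp_rw [h2] at key
  rw [h1]
  have h3 : ∀ ξ, 𝓕⁻ u ξ = VectorFourier.fourierIntegral Real.fourierChar volume (-innerₗ R3) u ξ :=
    fun ξ ↦ by
      rw [SchwartzMap.fourierInv_coe]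
      rfl
  simp_rw [h3]
  rw [key, ← integral_add_left_eq_self _ y]
  congr 1
  funext t
  rw [add_sub_cancel_left, smul_eq_mul, mul_comm]

theorem IsRepresentedBy.fourierMultiplier_schwartz {f : 𝓢'(R3, ℂ)} {F : R3 → ℂ} {A N N₁ : ℝ≥0}
    (h : IsRepresentedBy f F A) (τ : 𝓢(R3, ℂ)) (hk : IsKernel N N₁ (kernel τ)) :
    IsRepresentedBy (fourierMultiplierCLM ℂ τ f) (conv (kernel τ) F) (N * A) where
  measurable := measurable_conv hk.measurable h.measurable
  enorm_le y := by
    rw [ENNReal.coe_mul]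
    exact hk.enorm_conv_le h.enorm_le y
  apply_eq g := by
    have hFm := h.measurable
    rw [fourierMultiplierCLM_apply_apply, h.apply_eq]
    simp_rw [fourier_mul_fourierInv_apply]
    have hA' : ∀ y, ‖F y‖ ≤ A := fun y ↦ by
      have := h.enorm_le y
      rwa [enorm_eq_nnnorm, ENNReal.coe_le_coe] at this
    have hprod : Integrable (Function.uncurry fun y t : R3 ↦ g y * (kernel τ t * F (y - t)))
        (volume.prod volume) := by
      have h1 : Integrable (fun p : R3 × R3 ↦ g p.1 * kernel τ p.2) (volume.prod volume) :=
        g.integrable.mul_prod hk.integrable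
      have h2 := h1.mul_bdd (c := (A : ℝ)) (g := fun p : R3 × R3 ↦ F (p.1 - p.2))
        (hFm.comp (measurable_fst.sub measurable_snd)).aestronglyMeasurable
        (Eventually.of_forall fun p ↦ hA' _)
      convert h2 using 2 with p
      simp only [Function.uncurry]
      ring
    have hprod' : Integrable (Function.uncurry fun y t : R3 ↦ kernel τ t * g (y + t) * F y)
        (volume.prod volume) := by
      have h1 : Integrable (fun p : R3 × R3 ↦ kernel τ p.2 * g (p.1 + p.2)) (volume.prod volume) := by
        have h0 : Integrable (fun p : R3 × R3 ↦ g p.1 * kernel τ p.2) (volume.prod volume) :=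
          g.integrable.mul_prod hk.integrable
        have hmp := measurePreserving_add_prod (volume : Measure R3) (volume : Measure R3)
        have := hmp.integrable_comp_of_integrable h0
        convert this using 2 with p
        exact mul_comm _ _
      exact h1.mul_bdd (c := (A : ℝ)) (g := fun p : R3 × R3 ↦ F p.1)
        (hFm.comp measurable_fst).aestronglyMeasurable (Eventually.of_forall fun p ↦ hA' _)
    calc ∫ y, (∫ t, kernel τ t * g (y + t)) * F y = ∫ y, ∫ t, kernel τ t * g (y + t) * F y := by
          simp_rw [integral_mul_const]
      _ = ∫ t, ∫ y, kernel τ t * g (y + t) * F y := integral_integral_swap hprod'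
      _ = ∫ t, ∫ y, g y * (kernel τ t * F (y - t)) := by
          congr 1
          funext t
          rw [← integral_sub_right_eq_self (fun y ↦ kernel τ t * g (y + t) * F y) t]
          congr 1
          funext y
          rw [sub_add_cancel]
          ring
      _ = ∫ y, ∫ t, g y * (kernel τ t * F (y - t)) := (integral_integral_swap hprod).symm
      _ = _ := by
          simp_rw [integral_const_mul]
          rfl

/-- The multiplier with symbol `σ(ξ / l)` is the convolution with the kernel `l³ k(l ·)`, where `k`
is the inverse Fourier transform of `σ`. -/
theorem IsRepresentedBy.fourierMultiplier {f : 𝓢'(R3, ℂ)} {F : R3 → ℂ} {A N N₁ : ℝ≥0}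
    (h : IsRepresentedBy f F A) (σ : 𝓢(R3, ℂ)) (hk : IsKernel N N₁ (kernel σ)) {l : ℝ≥0}
    (hl : l ≠ 0) {m : R3 → ℂ} (hm : ∀ ξ, m ξ = σ ((l : ℝ)⁻¹ • ξ)) :
    IsRepresentedBy (fourierMultiplierCLM ℂ m f) (conv (dilate l (kernel σ)) F) (N * A) := by
  obtain ⟨τ, hτ, hτ'⟩ := exists_schwartz_scaled σ hl
  have e1 : m = τ := funext fun ξ ↦ (hm ξ).trans (hτ ξ).symm
  have e2 : ⇑(kernel τ) = dilate l (kernel σ) := funext hτ'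
  have hk' := hk.dilate hl
  rw [← e2] at hk' ⊢
  rw [e1]
  exact h.fourierMultiplier_schwartz τ hk'

theorem integral_fourierInv_schwartz (σ : 𝓢(R3, ℂ)) : ∫ t, kernel σ t = σ 0 := by
  have h : 𝓕 (kernel σ) 0 = σ 0 := by rw [FourierTransform.fourier_fourierInv_eq]
  rw [← h, SchwartzMap.fourier_coe, Real.fourier_eq]
  simp

/-! ### Symbols of dyadic partitions -/

namespace DyadicPartition

variable (Ψ : DyadicPartition)

theorem contDiff_ofReal_χ : ContDiff ℝ ∞ fun ξ ↦ (Ψ.χ ξ : ℂ) :=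
  Complex.ofRealCLM.contDiff.comp Ψ.contDiff_χ

theorem contDiff_ofReal_φ : ContDiff ℝ ∞ fun ξ ↦ (Ψ.φ ξ : ℂ) :=
  Complex.ofRealCLM.contDiff.comp Ψ.contDiff_φ

/-- The function `χ`, as a complex Schwartz function. -/
def χSchwartz : 𝓢(R3, ℂ) :=
  (Ψ.hasCompactSupport_χ.comp_left (g := Complex.ofReal) rfl).toSchwartzMap Ψ.contDiff_ofReal_χ

/-- The function `φ`, as a complex Schwartz function. -/
def φSchwartz : 𝓢(R3, ℂ) :=
  (Ψ.hasCompactSupport_φ.comp_left (g := Complex.ofReal) rfl).toSchwartzMap Ψ.contDiff_ofReal_φ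

@[simp]
theorem χSchwartz_apply (ξ : R3) : Ψ.χSchwartz ξ = (Ψ.χ ξ : ℂ) := rfl

@[simp]
theorem φSchwartz_apply (ξ : R3) : Ψ.φSchwartz ξ = (Ψ.φ ξ : ℂ) := rfl

/-- The profile of the `n`-th block: `χ` for `n = 0`, and `φ` otherwise. -/
def profile : ℕ → 𝓢(R3, ℂ)
  | 0 => Ψ.χSchwartz
  | _ + 1 => Ψ.φSchwartz

/-- The frequency scale of the `n`-th block: `1` for `n = 0`, and `2ⁿ⁻¹` otherwise. -/
def scale : ℕ → ℝ≥0
  | 0 => 1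
  | m + 1 => 2 ^ m

theorem one_le_scale (n : ℕ) : 1 ≤ scale n := by
  cases n with
  | zero => exact le_rfl
  | succ m => exact one_le_pow₀ one_le_two

theorem scale_le (n : ℕ) : scale n ≤ 2 ^ n := by
  cases n with
  | zero => simp [scale]
  | succ m => exact pow_le_pow_right₀ one_le_two (Nat.le_succ m)

theorem blockSymbol_eq (n : ℕ) (ξ : R3) :
    Ψ.blockSymbol n ξ = Ψ.profile n ((scale n : ℝ)⁻¹ • ξ) := by
  cases n with
  | zero => simp [blockSymbol, profile, scale]
  | succ m => simp [blockSymbol, profile, scale]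

theorem hasTemperateGrowth_comp_smul (σ : 𝓢(R3, ℂ)) (c : ℝ) :
    (fun ξ : R3 ↦ σ (c • ξ)).HasTemperateGrowth :=
  σ.hasTemperateGrowth.comp (c • ContinuousLinearMap.id ℝ R3).hasTemperateGrowth

theorem hasTemperateGrowth_blockSymbol (n : ℕ) : (Ψ.blockSymbol n).HasTemperateGrowth := by
  rw [funext (Ψ.blockSymbol_eq n)]
  exact hasTemperateGrowth_comp_smul _ _

theorem hasTemperateGrowth_lowFreq (n : ℕ) :
    (fun ξ ↦ (Ψ.χ (((2 : ℝ) ^ n)⁻¹ • ξ) : ℂ)).HasTemperateGrowth :=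
  hasTemperateGrowth_comp_smul Ψ.χSchwartz _

/-- Near the origin `φ` vanishes, and therefore `χ` is equal to one. -/
theorem exists_ball : ∃ a > 0, ∀ ξ : R3, ‖ξ‖ < a → Ψ.φ ξ = 0 ∧ Ψ.χ ξ = 1 := by
  have h : (tsupport Ψ.φ)ᶜ ∈ 𝓝 (0 : R3) :=
    (isClosed_tsupport _).isOpen_compl.mem_nhds Ψ.zero_notMem_tsupport_φ
  obtain ⟨a, ha, hball⟩ := Metric.mem_nhds_iff.1 h
  have hφ : ∀ ξ : R3, ‖ξ‖ < a → Ψ.φ ξ = 0 := fun ξ hξ ↦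
    image_eq_zero_of_notMem_tsupport (hball (by simpa using hξ))
  refine ⟨a, ha, fun ξ hξ ↦ ⟨hφ ξ hξ, ?_⟩⟩
  have h0 : ∀ n : ℕ, Ψ.φ (((2 : ℝ) ^ n)⁻¹ • ξ) = 0 := fun n ↦ by
    refine hφ _ (lt_of_le_of_lt ?_ hξ)
    rw [norm_smul, norm_inv, norm_pow, Real.norm_ofNat]
    exact mul_le_of_le_one_left (norm_nonneg _) (inv_le_one_of_one_le₀ (one_le_pow₀ one_le_two))
  have hs := Ψ.hasSum_one ξ
  simp_rw [h0] at hs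
  have := hs.unique hasSum_zero
  linarith

theorem exists_radius : ∃ R > 0, ∀ ξ : R3, R ≤ ‖ξ‖ → Ψ.φ ξ = 0 ∧ Ψ.χ ξ = 0 := by
  obtain ⟨R₁, h₁⟩ := Ψ.hasCompactSupport_φ.isCompact.isBounded.subset_ball 0
  obtain ⟨R₂, h₂⟩ := Ψ.hasCompactSupport_χ.isCompact.isBounded.subset_ball 0
  refine ⟨max 1 (max R₁ R₂), by positivity, fun ξ hξ ↦ ⟨?_, ?_⟩⟩
  · refine image_eq_zero_of_notMem_tsupport fun h ↦ ?_
    have := h₁ h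
    rw [mem_ball_zero_iff] at this
    have h3 := (le_max_left R₁ R₂).trans ((le_max_right _ _).trans hξ)
    linarith
  · refine image_eq_zero_of_notMem_tsupport fun h ↦ ?_
    have := h₂ h
    rw [mem_ball_zero_iff] at this
    have h3 := (le_max_right R₁ R₂).trans ((le_max_right _ _).trans hξ)
    linarith

theorem χ_half (ξ : R3) : Ψ.χ ((2 : ℝ)⁻¹ • ξ) = Ψ.χ ξ + Ψ.φ ξ := by
  have h1 := Ψ.hasSum_one ((2 : ℝ)⁻¹ • ξ)
  have h2 := (hasSum_nat_add_iff' 1).2 (Ψ.hasSum_one ξ)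
  have e : ∀ n : ℕ, Ψ.φ (((2 : ℝ) ^ n)⁻¹ • (2 : ℝ)⁻¹ • ξ) = Ψ.φ (((2 : ℝ) ^ (n + 1))⁻¹ • ξ) :=
    fun n ↦ by rw [smul_smul, pow_succ, mul_inv]
  simp_rw [e] at h1
  have := h1.unique h2
  simp at this
  linarith

theorem sum_blockSymbol (N : ℕ) (ξ : R3) :
    ∑ n ∈ Finset.range (N + 1), Ψ.blockSymbol n ξ = (Ψ.χ (((2 : ℝ) ^ N)⁻¹ • ξ) : ℂ) := by
  induction N with
  | zero => simp [blockSymbol]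
  | succ N ih =>
    have h := Ψ.χ_half (((2 : ℝ) ^ N)⁻¹ • ξ)
    have e : ((2 : ℝ) ^ (N + 1))⁻¹ • ξ = (2 : ℝ)⁻¹ • ((2 : ℝ) ^ N)⁻¹ • ξ := by
      rw [smul_smul, pow_succ, mul_inv, mul_comm]
    rw [Finset.sum_range_succ, ih, e, h]
    simp [blockSymbol]

/-- A Schwartz function that is equal to one where `φ` does not vanish and equal to zero at the
origin: `χ(2⁻ᴺ ·) - χ(2ᴺ ·)` for large `N`. -/
theorem exists_fattened : ∃ Φ : 𝓢(R3, ℂ), Φ 0 = 0 ∧ ∀ ξ, Ψ.φ ξ * Φ ξ = Ψ.φ ξ := by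
  obtain ⟨a, ha, hball⟩ := Ψ.exists_ball
  obtain ⟨R, hR, hrad⟩ := Ψ.exists_radius
  obtain ⟨N, hN⟩ := pow_unbounded_of_one_lt (R / a) one_lt_two
  rw [div_lt_iff₀ ha] at hN
  have h2 : (2 : ℝ≥0) ^ N ≠ 0 := by positivity
  obtain ⟨τ₁, hτ₁, -⟩ := exists_schwartz_scaled Ψ.χSchwartz h2
  obtain ⟨τ₂, hτ₂, -⟩ := exists_schwartz_scaled Ψ.χSchwartz (inv_ne_zero h2)
  refine ⟨τ₁ - τ₂, by simp [hτ₁, hτ₂], fun ξ ↦ ?_⟩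
  rcases eq_or_ne (Ψ.φ ξ) 0 with h | h
  · simp [h]
  have hξa : a ≤ ‖ξ‖ := by
    by_contra! h'
    exact h (hball ξ h').1
  have hξR : ‖ξ‖ < R := by
    by_contra! h'
    exact h (hrad ξ h').1
  have hpos : (0 : ℝ) < 2 ^ N := by positivity
  have e1 : Ψ.χ (((2 : ℝ) ^ N)⁻¹ • ξ) = 1 := by
    refine (hball _ ?_).2
    rw [norm_smul, norm_inv, norm_pow, Real.norm_ofNat, inv_mul_lt_iff₀ hpos]
    exact hξR.trans hN
  have e2 : Ψ.χ (((2 : ℝ) ^ N) • ξ) = 0 := by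
    refine (hrad _ ?_).2
    rw [norm_smul, norm_pow, Real.norm_ofNat]
    exact hN.le.trans (by gcongr)
  rw [sub_apply, hτ₁, hτ₂]
  simp [e1, e2]

/-- High blocks do not meet the support of a fixed low frequency cut-off. -/
theorem exists_blockSymbol_mul_eq_zero (Ψ' : DyadicPartition) (n : ℕ) :
    ∃ N, ∀ m ≥ N, ∀ ξ, Ψ.blockSymbol m ξ * (Ψ'.χ (((2 : ℝ) ^ n)⁻¹ • ξ) : ℂ) = 0 := by
  obtain ⟨a, ha, hball⟩ := Ψ.exists_ball
  obtain ⟨R, hR, hrad⟩ := Ψ'.exists_radius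
  obtain ⟨N, hN⟩ := pow_unbounded_of_one_lt (2 ^ n * R / a) one_lt_two
  rw [div_lt_iff₀ ha] at hN
  refine ⟨N + 1, fun m hm ξ ↦ ?_⟩
  obtain ⟨m, rfl⟩ : ∃ k, m = k + 1 := ⟨m - 1, by omega⟩
  have hpos : (0 : ℝ) < 2 ^ n := by positivity
  have hposm : (0 : ℝ) < 2 ^ m := by positivity
  rcases le_or_gt (2 ^ n * R) ‖ξ‖ with h | h
  · rw [(hrad _ _).2]
    · simp
    · rw [norm_smul, norm_inv, norm_pow, Real.norm_ofNat, le_inv_mul_iff₀ hpos]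
      exact h
  · have : Ψ.φ (((2 : ℝ) ^ m)⁻¹ • ξ) = 0 := by
      refine (hball _ ?_).1
      rw [norm_smul, norm_inv, norm_pow, Real.norm_ofNat, inv_mul_lt_iff₀ hposm]
      refine (h.trans hN).trans_le ?_
      have : N ≤ m := by omega
      gcongr
      exact one_le_two
    simp [blockSymbol, this]

/-- A fixed block is not affected by low frequency cut-offs of high index. -/
theorem exists_blockSymbol_mul_eq_self (Ψ' : DyadicPartition) (m : ℕ) :
    ∃ N, ∀ n ≥ N, ∀ ξ,
      Ψ.blockSymbol m ξ * (Ψ'.χ (((2 : ℝ) ^ n)⁻¹ • ξ) : ℂ) = Ψ.blockSymbol m ξ := by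
  obtain ⟨a, ha, hball⟩ := Ψ'.exists_ball
  obtain ⟨R, hR, hrad⟩ := Ψ.exists_radius
  obtain ⟨N, hN⟩ := pow_unbounded_of_one_lt (scale m * R / a) one_lt_two
  rw [div_lt_iff₀ ha] at hN
  refine ⟨N, fun n hn ξ ↦ ?_⟩
  have hposn : (0 : ℝ) < 2 ^ n := by positivity
  have hpos : (0 : ℝ) < scale m := zero_lt_one.trans_le (one_le_scale m)
  rcases le_or_gt (scale m * R) ‖ξ‖ with h | h
  · have h0 : R ≤ ‖((scale m : ℝ))⁻¹ • ξ‖ := by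
      rw [norm_smul, norm_inv, NNReal.norm_eq, le_inv_mul_iff₀ hpos]
      exact h
    have : Ψ.blockSymbol m ξ = 0 := by
      rw [blockSymbol_eq]
      cases m with
      | zero => simp [profile, (hrad _ h0).2]
      | succ m => simp [profile, (hrad _ h0).1]
    simp [this]
  · rw [(hball _ _).2]
    · simp
    · rw [norm_smul, norm_inv, norm_pow, Real.norm_ofNat, inv_mul_lt_iff₀ hposn]
      refine (h.trans hN).trans_le ?_
      gcongr
      exact one_le_two

theorem lowFreq_eq_sum (N : ℕ) (f : 𝓢'(R3, ℂ)) :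
    Ψ.lowFreq N f = ∑ m ∈ Finset.range (N + 1), Ψ.block m f := by
  have h := fourierMultiplierCLM_sum ℂ (s := Finset.range (N + 1))
    (fun m _ ↦ Ψ.hasTemperateGrowth_blockSymbol m)
  simp_rw [sum_blockSymbol] at h
  rw [lowFreq, h, sum_apply]
  rfl

/-- A low frequency cut-off of `f` is the finite sum of the cut-offs of the blocks of `f` with
respect to any other dyadic partition. -/
theorem exists_lowFreq_eq_sum (Ψ' : DyadicPartition) (n : ℕ) :
    ∃ N, (∀ m ≥ N, ∀ f, Ψ'.lowFreq n (Ψ.block m f) = 0) ∧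
      ∀ f, Ψ'.lowFreq n f = ∑ m ∈ Finset.range N, Ψ'.lowFreq n (Ψ.block m f) := by
  obtain ⟨N₁, hN₁⟩ := Ψ.exists_blockSymbol_mul_eq_zero Ψ' n
  have hzero : ∀ m ≥ N₁, ∀ f, Ψ'.lowFreq n (Ψ.block m f) = 0 := by
    intro m hm f
    rw [lowFreq, block, fourierMultiplierCLM_fourierMultiplierCLM_apply
      (Ψ.hasTemperateGrowth_blockSymbol m) (Ψ'.hasTemperateGrowth_lowFreq n)]
    have : (Ψ.blockSymbol m * fun ξ ↦ (Ψ'.χ (((2 : ℝ) ^ n)⁻¹ • ξ) : ℂ)) = fun _ ↦ 0 :=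
      funext (hN₁ m hm)
    rw [this, fourierMultiplierCLM_const]
    simp
  obtain ⟨a, ha, hball⟩ := Ψ.exists_ball
  obtain ⟨R, hR, hrad⟩ := Ψ'.exists_radius
  obtain ⟨N₂, hN₂⟩ := pow_unbounded_of_one_lt (2 ^ n * R / a) one_lt_two
  rw [div_lt_iff₀ ha] at hN₂
  set N := max N₁ N₂
  refine ⟨N + 1, fun m hm ↦ hzero m (by omega), fun f ↦ ?_⟩
  rw [← map_sum, ← lowFreq_eq_sum]
  conv_rhs => rw [lowFreq, lowFreq, fourierMultiplierCLM_fourierMultiplierCLM_apply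
    (Ψ.hasTemperateGrowth_lowFreq N) (Ψ'.hasTemperateGrowth_lowFreq n)]
  rw [lowFreq]
  congr 2
  funext ξ
  rw [Pi.mul_apply]
  have hpos : (0 : ℝ) < 2 ^ n := by positivity
  have hposN : (0 : ℝ) < 2 ^ N := by positivity
  rcases le_or_gt (2 ^ n * R) ‖ξ‖ with h | h
  · have : Ψ'.χ (((2 : ℝ) ^ n)⁻¹ • ξ) = 0 := by
      refine (hrad _ ?_).2
      rw [norm_smul, norm_inv, norm_pow, Real.norm_ofNat, le_inv_mul_iff₀ hpos]
      exact h
    simp [this]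
  · have : Ψ.χ (((2 : ℝ) ^ N)⁻¹ • ξ) = 1 := by
      refine (hball _ ?_).2
      rw [norm_smul, norm_inv, norm_pow, Real.norm_ofNat, inv_mul_lt_iff₀ hposN]
      refine (h.trans hN₂).trans_le ?_
      have : N₂ ≤ N := le_max_right _ _
      gcongr
      exact one_le_two
    simp [this]

theorem exists_lowFreq_block_eq (Ψ' : DyadicPartition) (m : ℕ) :
    ∃ N, ∀ n ≥ N, ∀ f, Ψ'.lowFreq n (Ψ.block m f) = Ψ.block m f := by
  obtain ⟨N, hN⟩ := Ψ.exists_blockSymbol_mul_eq_self Ψ' m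
  refine ⟨N, fun n hn f ↦ ?_⟩
  rw [lowFreq, block, fourierMultiplierCLM_fourierMultiplierCLM_apply
    (Ψ.hasTemperateGrowth_blockSymbol m) (Ψ'.hasTemperateGrowth_lowFreq n)]
  congr 2
  exact funext (hN n hn)

end DyadicPartition

/-! ### The pairing of a block with a function of bounded variation -/

namespace DyadicPartition

variable (Ψ : DyadicPartition)

/-- The distribution `f` is spectrally localized like the `n`-th block: it is invariant under all
multipliers whose symbols are equal to one where the symbol of the block does not vanish. -/
def IsLocalized (n : ℕ) (f : 𝓢'(R3, ℂ)) : Prop :=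
  ∀ θ : R3 → ℂ, θ.HasTemperateGrowth → (∀ ξ, Ψ.blockSymbol n ξ * θ ξ = Ψ.blockSymbol n ξ) →
    fourierMultiplierCLM ℂ θ f = f

variable {Ψ}

theorem isLocalized_block (n : ℕ) (f : 𝓢'(R3, ℂ)) : Ψ.IsLocalized n (Ψ.block n f) := by
  intro θ hθ h
  rw [block, fourierMultiplierCLM_fourierMultiplierCLM_apply
    (Ψ.hasTemperateGrowth_blockSymbol n) hθ]
  congr 2
  exact funext h

theorem IsLocalized.lowFreq {n : ℕ} {f : 𝓢'(R3, ℂ)} (hf : Ψ.IsLocalized n f)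
    (Ψ' : DyadicPartition) (k : ℕ) : Ψ.IsLocalized n (Ψ'.lowFreq k f) := by
  intro θ hθ h
  conv_rhs => rw [← hf θ hθ h]
  have hχ := Ψ'.hasTemperateGrowth_lowFreq k
  rw [DyadicPartition.lowFreq, fourierMultiplierCLM_fourierMultiplierCLM_apply hχ hθ,
    fourierMultiplierCLM_fourierMultiplierCLM_apply hθ hχ, mul_comm]

variable (Ψ)

/-- The key estimate. The pairing of a block at frequency `2ⁿ` with the product of a function of
bounded variation and a bump of width `1 / l` gains a factor `l / 2ⁿ`, the quotient of the wave
length and the width of the bump. -/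
theorem exists_pairing_bound : ∃ C : ℝ≥0, ∀ {n : ℕ} {f : 𝓢'(R3, ℂ)} {F : R3 → ℂ} {A : ℝ≥0},
    Ψ.IsLocalized n f → IsRepresentedBy f F A → ∀ {u : R3 → ℂ} {B : ℝ≥0}, HasBVBound B u →
    ∀ {g : R3 → ℂ} {D l : ℝ≥0} {x : R3}, IsBump D l x g → 1 ≤ l →
    ‖∫ y, u y * g y * F y‖ₑ ≤ (C * A * B * D * min 1 (l / 2 ^ n) : ℝ≥0) := by
  obtain ⟨Φ, hΦ0, hΦ⟩ := Ψ.exists_fattened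
  obtain ⟨N, N₁, hk⟩ := exists_isKernel_schwartz (kernel Φ)
  refine ⟨weightMass + 4 * N₁, fun {n f F A} hf hF {u B} hu {g D l x} hg hl ↦ ?_⟩
  have hl0 : l ≠ 0 := (zero_lt_one.trans_le hl).ne'
  have hug := hu.lintegral_enorm_mul_le hg hl0
  have htriv : ‖∫ y, u y * g y * F y‖ₑ ≤ (weightMass * A * B * D : ℝ≥0) := by
    refine (enorm_integral_le_lintegral_enorm _).trans ?_
    calc ∫⁻ y, ‖u y * g y * F y‖ₑ ≤ ∫⁻ y, ‖u y * g y‖ₑ * A := by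
          gcongr with y
          rw [enorm_mul (u y * g y)]
          gcongr
          exact hF.enorm_le y
      _ = (∫⁻ y, ‖u y * g y‖ₑ) * A := lintegral_mul_const' _ _ (by finiteness)
      _ ≤ B * (D * weightMass) * A := by gcongr
      _ = _ := by
          push_cast
          ring
  have h1 : ‖∫ y, u y * g y * F y‖ₑ ≤ ((weightMass + 4 * N₁) * A * B * D * 1 : ℝ≥0) := by
    refine htriv.trans ?_
    rw [ENNReal.coe_le_coe, mul_one]
    gcongr
    exact le_self_add
  rcases min_choice 1 (l / 2 ^ n) with h | h
  · rw [h]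
    exact h1
  cases n with
  | zero =>
    rw [min_eq_left (by simpa using hl)]
    exact h1
  | succ m =>
    rw [h]
    have h2 : (2 : ℝ≥0) ^ m ≠ 0 := by positivity
    have hloc : fourierMultiplierCLM ℂ (fun ξ ↦ Φ ((((2 : ℝ≥0) ^ m : ℝ≥0) : ℝ)⁻¹ • ξ)) f = f := by
      refine hf _ (hasTemperateGrowth_comp_smul _ _) fun ξ ↦ ?_
      have := hΦ (((2 : ℝ) ^ m)⁻¹ • ξ)
      simpa [blockSymbol] using this
    have hrep := hF.fourierMultiplier Φ hk h2 (m := fun ξ ↦ Φ ((((2 : ℝ≥0) ^ m : ℝ≥0) : ℝ)⁻¹ • ξ))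
      (fun ξ ↦ rfl)
    rw [hloc] at hrep
    have hk0 : ∫ t, dilate (2 ^ m) (kernel Φ) t = 0 := by
      rw [integral_dilate h2, integral_fourierInv_schwartz, hΦ0]
    have key := (hk.dilate h2).enorm_integral_mul_le hk0 hF.measurable hF.enorm_le
      (hF.ae_eq hrep) (hu.measurable.mul hg.measurable)
      (hug.trans_lt (by finiteness)) (B := 2 * B * D * l) (by finiteness)
      (hu.lintegral_translate_mul_le hg hl)
    refine key.trans ?_
    have e : (((2 : ℝ≥0) ^ m)⁻¹ * N₁ * A * (2 * B * D * l) : ℝ≥0) ≤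
        (weightMass + 4 * N₁) * A * B * D * (l / 2 ^ (m + 1)) := by
      have : (((2 : ℝ≥0) ^ m)⁻¹ * N₁ * A * (2 * B * D * l) : ℝ≥0) =
          (4 * N₁) * A * B * D * (l / 2 ^ (m + 1)) := by
        field_simp
        ring
      rw [this]
      gcongr
      exact le_add_self
    exact_mod_cast e

end DyadicPartition

/-! ### A geometric series -/

/-- For `1 < q < 2` the series `∑ min(1, 2ʲ / 2ⁿ) qⁿ` is dominated by its term with index `j`. -/
theorem exists_tsum_min_mul_pow_le {q : ℝ≥0} (hq1 : 1 < q) (hq2 : q < 2) :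
    ∃ C : ℝ≥0, ∀ j : ℕ, Summable (fun n : ℕ ↦ min 1 ((2 : ℝ≥0) ^ j / 2 ^ n) * q ^ n) ∧
      ∑' n : ℕ, min 1 ((2 : ℝ≥0) ^ j / 2 ^ n) * q ^ n ≤ C * q ^ j := by
  have hlt : q / 2 < 1 := by rw [div_lt_one two_pos]; exact hq2
  have hgeo : Summable fun n : ℕ ↦ (q / 2) ^ n := NNReal.summable_geometric hlt
  have hsum : ∀ j : ℕ, Summable (fun n : ℕ ↦ min 1 ((2 : ℝ≥0) ^ j / 2 ^ n) * q ^ n) := fun j ↦ by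
    refine NNReal.summable_of_le (fun n ↦ ?_) (hgeo.mul_left (2 ^ j))
    refine (mul_le_mul' (min_le_right _ _) le_rfl).trans_eq ?_
    rw [div_pow]
    ring
  set S : ℝ≥0 := ∑' n : ℕ, min 1 ((2 : ℝ≥0) ^ 0 / 2 ^ n) * q ^ n
  refine ⟨S + (q - 1)⁻¹, fun j ↦ ⟨hsum j, ?_⟩⟩
  have hq : (q - 1) + 1 = q := tsub_add_cancel_of_le hq1.le
  have hq0 : q - 1 ≠ 0 := (tsub_pos_of_lt hq1).ne'
  -- the sums satisfy the recursion `s (j + 1) = 1 + q s j`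
  have key : ∑' n : ℕ, min 1 ((2 : ℝ≥0) ^ j / 2 ^ n) * q ^ n + (q - 1)⁻¹ ≤
      (S + (q - 1)⁻¹) * q ^ j := by
    induction j with
    | zero => simp [S]
    | succ j ih =>
      have hrec : ∑' n : ℕ, min 1 ((2 : ℝ≥0) ^ (j + 1) / 2 ^ n) * q ^ n =
          1 + q * ∑' n : ℕ, min 1 ((2 : ℝ≥0) ^ j / 2 ^ n) * q ^ n := by
        have h0 : min 1 ((2 : ℝ≥0) ^ (j + 1) / 2 ^ 0) * q ^ 0 = 1 := by
          have : (1 : ℝ≥0) ≤ 2 ^ (j + 1) := one_le_pow₀ one_le_two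
          simp [this]
        have h1 : ∀ n : ℕ, min 1 ((2 : ℝ≥0) ^ (j + 1) / 2 ^ (n + 1)) * q ^ (n + 1) =
            q * (min 1 ((2 : ℝ≥0) ^ j / 2 ^ n) * q ^ n) := fun n ↦ by
          rw [pow_succ (2 : ℝ≥0) j, pow_succ (2 : ℝ≥0) n, mul_div_mul_right _ _ two_ne_zero]
          ring
        rw [tsum_eq_zero_add' (by simpa only [h1] using (hsum j).mul_left q), h0]
        simp_rw [h1]
        rw [NNReal.tsum_mul_left]
      rw [hrec]
      calc 1 + q * (∑' n : ℕ, min 1 ((2 : ℝ≥0) ^ j / 2 ^ n) * q ^ n) + (q - 1)⁻¹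
          = q * (∑' n : ℕ, min 1 ((2 : ℝ≥0) ^ j / 2 ^ n) * q ^ n + (q - 1)⁻¹) := by
            have : 1 + (q - 1)⁻¹ = q * (q - 1)⁻¹ := by
              nth_rewrite 2 [← hq]
              rw [add_mul, mul_inv_cancel₀ hq0, one_mul]
            rw [mul_add, ← this]
            ring
        _ ≤ q * ((S + (q - 1)⁻¹) * q ^ j) := by gcongr
        _ = _ := by ring
  exact le_self_add.trans key

/-! ### The product -/

/-- A series of distributions that is dominated by a seminorm converges. -/
theorem exists_hasSum_of_le_bumpSeminorm {T : ℕ → 𝓢'(R3, ℂ)} {b : ℕ → ℝ} (hb : Summable b)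
    (hT : ∀ n g, ‖T n g‖ ≤ b n * bumpSeminorm g) :
    ∃ w : 𝓢'(R3, ℂ), ∀ g, HasSum (fun n ↦ T n g) (w g) := by
  have hs : ∀ g, Summable fun n ↦ T n g := fun g ↦
    .of_norm_bounded (hb.mul_right (bumpSeminorm g)) fun n ↦ hT n g
  let w : 𝓢(R3, ℂ) →L[ℂ] ℂ := SchwartzMap.mkCLMtoNormedSpace (σ := RingHom.id ℂ)
    (fun g ↦ ∑' n, T n g)
    (fun f g ↦ by simp_rw [map_add]; exact (hs f).tsum_add (hs g))
    (fun c g ↦ by simp_rw [map_smul, smul_eq_mul, RingHom.id_apply]; exact tsum_mul_left)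
    ⟨Finset.Iic (4, 1), |∑' n, b n|, abs_nonneg _, fun g ↦ by
      have h := tsum_of_norm_bounded (hb.mul_right (bumpSeminorm g)).hasSum fun n ↦ hT n g
      rw [tsum_mul_right] at h
      refine h.trans ?_
      exact mul_le_mul_of_nonneg_right (le_abs_self _) (apply_nonneg _ _)⟩
  exact ⟨ContinuousLinearMap.toPointwiseConvergenceCLM _ _ _ _ w, fun g ↦ (hs g).hasSum⟩

namespace DyadicPartition

variable (Ψ : DyadicPartition)

theorem exists_isRepresentedBy_block {r : ℝ} (hr : r < 1) {f : 𝓢'(R3, ℂ)}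
    (hf : holderNorm Ψ (r - 1) f ≠ ⊤) (n : ℕ) :
    ∃ F, IsRepresentedBy (Ψ.block n f) F
      ((2 ^ (1 - r)) ^ n * (holderNorm Ψ (r - 1) f).toNNReal) := by
  set H := holderNorm Ψ (r - 1) f
  have h2 : (0 : ℝ) < 2 ^ (((n : ℝ) - 1) * (r - 1)) := by positivity
  have hle : ENNReal.ofReal ((2 : ℝ) ^ (((n : ℝ) - 1) * (r - 1))) * linftyNorm (Ψ.block n f) ≤ H :=
    le_iSup (fun n : ℕ ↦ ENNReal.ofReal ((2 : ℝ) ^ (((n : ℝ) - 1) * (r - 1))) *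
      linftyNorm (Ψ.block n f)) n
  have hle' : linftyNorm (Ψ.block n f) ≤ (((2 ^ (1 - r)) ^ n * H.toNNReal : ℝ≥0) : ℝ≥0∞) := by
    rw [mul_comm, ← ENNReal.le_div_iff_mul_le (by simp [h2]) (by simp)] at hle
    refine hle.trans ?_
    rw [ENNReal.div_eq_inv_mul, ENNReal.coe_mul, ENNReal.coe_toNNReal hf,
      ← ENNReal.ofReal_inv_of_pos h2, ← ENNReal.ofReal_coe_nnreal]
    gcongr
    rw [← Real.rpow_neg two_pos.le]
    push_cast
    rw [← Real.rpow_mul_natCast two_pos.le]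
    refine Real.rpow_le_rpow_of_exponent_le one_le_two ?_
    linarith
  obtain ⟨F, hF⟩ := exists_isRepresentedBy_of_linftyNorm
    (ne_top_of_le_ne_top ENNReal.coe_ne_top hle')
  refine ⟨F, hF.measurable, fun y ↦ (hF.enorm_le y).trans ?_, hF.apply_eq⟩
  rw [ENNReal.coe_le_coe]
  exact ENNReal.toNNReal_mono ENNReal.coe_ne_top hle'

/-- The blocks of the product `u f` are sums of contributions of the blocks of `f`, which decay
geometrically away from the diagonal. -/
theorem exists_product_series {r : ℝ} (hr₀ : 0 < r) (hr₁ : r < 1) {u : R3 → ℂ} {B : ℝ≥0}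
    (hu : HasBVBound B u) : ∃ C : ℝ≥0, ∀ f, holderNorm Ψ (r - 1) f ≠ ⊤ → ∃ w,
      holderNorm Ψ (r - 1) w ≤ C * holderNorm Ψ (r - 1) f ∧
      ∃ F : ℕ → R3 → ℂ, (∀ n, IsRepresentedBy (Ψ.block n f) (F n)
        ((2 ^ (1 - r)) ^ n * (holderNorm Ψ (r - 1) f).toNNReal)) ∧
        ∀ g, HasSum (fun n ↦ ∫ y, u y * g y * F n y) (w g) := by
  obtain ⟨C₁, hC₁⟩ := Ψ.exists_pairing_bound
  set q : ℝ≥0 := 2 ^ (1 - r) with hq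
  have hq1 : 1 < q := NNReal.one_lt_rpow one_lt_two (by linarith)
  have hq2 : q < 2 := by
    have : (2 : ℝ≥0) ^ (1 - r) < 2 ^ (1 : ℝ) :=
      NNReal.rpow_lt_rpow_of_exponent_lt one_lt_two (by linarith)
    rwa [NNReal.rpow_one] at this
  obtain ⟨C₂, hC₂⟩ := exists_tsum_min_mul_pow_le hq1 hq2
  let d : 𝓢(R3, ℂ) → ℝ≥0 := fun k ↦ 256 * (1 + weightMass) * (bumpSeminorm k).toNNReal
  let D : ℝ≥0 := max (d (kernel Ψ.χSchwartz)) (d (kernel Ψ.φSchwartz))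
  have hD : ∀ j, d (kernel (Ψ.profile j)) ≤ D := fun j ↦ by
    cases j with
    | zero => exact le_max_left _ _
    | succ j => exact le_max_right _ _
  refine ⟨2 * (C₁ * B * D * C₂), fun f hf ↦ ?_⟩
  set H := holderNorm Ψ (r - 1) f
  choose F hF using Ψ.exists_isRepresentedBy_block hr₁ hf
  have hloc := fun n ↦ isLocalized_block (Ψ := Ψ) n f
  have huF : ∀ n y, ‖u y * F n y‖ₑ ≤ (B * (q ^ n * H.toNNReal) : ℝ≥0) := fun n y ↦ by
    rw [enorm_mul, ENNReal.coe_mul]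
    exact mul_le_mul' (hu.enorm_le y) ((hF n).enorm_le y)
  choose T hT using fun n ↦ exists_isRepresentedBy (hu.measurable.mul (hF n).measurable) (huF n)
  have hTapply : ∀ n g, T n g = ∫ y, u y * g y * F n y := fun n g ↦ by
    rw [(hT n).apply_eq]
    congr 1
    funext y
    rw [Pi.mul_apply]
    ring
  have hTle : ∀ n g, ‖T n g‖ ≤ ((C₁ * H.toNNReal * B * (256 * (1 + weightMass)) : ℝ≥0) *
      (min 1 ((2 : ℝ≥0) ^ 0 / 2 ^ n) * q ^ n : ℝ≥0) : ℝ) * bumpSeminorm g := fun n g ↦ by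
    have h := hC₁ (hloc n) (hF n) hu (isBump_schwartz g) le_rfl
    rw [← hTapply, enorm_eq_nnnorm, ENNReal.coe_le_coe, ← NNReal.coe_le_coe, coe_nnnorm] at h
    refine h.trans_eq ?_
    rw [pow_zero]
    simp only [NNReal.coe_mul, Real.coe_toNNReal _ (apply_nonneg bumpSeminorm g)]
    ring
  obtain ⟨w, hw⟩ := exists_hasSum_of_le_bumpSeminorm
    ((NNReal.summable_coe.2 (hC₂ 0).1).mul_left _) hTle
  refine ⟨w, ?_, F, hF, fun g ↦ by simpa only [hTapply] using hw g⟩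
  refine iSup_le fun j ↦ ?_
  have hsc := one_le_scale j
  have hsc0 : scale j ≠ 0 := (zero_lt_one.trans_le hsc).ne'
  obtain ⟨N, N₁, hk⟩ := exists_isKernel_schwartz (kernel (Ψ.profile j))
  set a : ℕ → ℝ≥0 := fun n ↦ C₁ * B * D * H.toNNReal * (min 1 ((2 : ℝ≥0) ^ j / 2 ^ n) * q ^ n)
  have hrep : ∀ n, IsRepresentedBy (Ψ.block j (T n))
      (conv (dilate (scale j) (kernel (Ψ.profile j))) (u * F n)) (a n) := by
    intro n
    have h := (hT n).fourierMultiplier (Ψ.profile j) hk hsc0 (Ψ.blockSymbol_eq j)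
    refine ⟨h.measurable, fun x ↦ ?_, h.apply_eq⟩
    -- at `x`, the block of `u F n` is the pairing of `F n` with `u` times a bump centered at `x`
    have e : conv (dilate (scale j) (kernel (Ψ.profile j))) (u * F n) x =
        ∫ y, u y * dilate (scale j) (kernel (Ψ.profile j)) (x - y) * F n y := by
      unfold conv
      rw [← integral_sub_left_eq_self _ volume x]
      congr 1
      funext y
      rw [sub_sub_cancel, Pi.mul_apply]
      ring
    rw [e]
    refine (hC₁ (hloc n) (hF n) hu ((isBump_schwartz _).dilate hsc0 x) hsc).trans ?_
    rw [ENNReal.coe_le_coe]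
    calc _ ≤ C₁ * (q ^ n * H.toNNReal) * B * D * min 1 (2 ^ j / 2 ^ n) := by
          gcongr
          · exact hD j
          · exact scale_le j
      _ = _ := by
          simp only [a]
          ring
  have hsum := isRepresentedBy_tsum hrep ((hC₂ j).1.mul_left _) (f := Ψ.block j w)
    (fun g ↦ hw _)
  have hle : linftyNorm (Ψ.block j w) ≤ ((C₁ * B * D * H.toNNReal * (C₂ * q ^ j) : ℝ≥0) : ℝ≥0∞) := by
    refine hsum.linftyNorm_le.trans ?_
    rw [ENNReal.coe_le_coe, NNReal.tsum_mul_left]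
    gcongr
    exact (hC₂ j).2
  have hpow : ENNReal.ofReal ((2 : ℝ) ^ (((j : ℝ) - 1) * (r - 1))) * (q ^ j : ℝ≥0) ≤ 2 := by
    rw [← ENNReal.ofReal_coe_nnreal, ← ENNReal.ofReal_mul (by positivity), hq]
    push_cast
    rw [← Real.rpow_mul_natCast two_pos.le, ← Real.rpow_add two_pos,
      ← ENNReal.ofReal_ofNat]
    apply ENNReal.ofReal_le_ofReal
    calc (2 : ℝ) ^ (((j : ℝ) - 1) * (r - 1) + (1 - r) * j) ≤ 2 ^ (1 : ℝ) :=
          Real.rpow_le_rpow_of_exponent_le one_le_two (by nlinarith)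
      _ = 2 := Real.rpow_one 2
  calc _ ≤ ENNReal.ofReal ((2 : ℝ) ^ (((j : ℝ) - 1) * (r - 1))) *
        ((C₁ * B * D * H.toNNReal * (C₂ * q ^ j) : ℝ≥0) : ℝ≥0∞) := by gcongr
    _ = (ENNReal.ofReal ((2 : ℝ) ^ (((j : ℝ) - 1) * (r - 1))) * (q ^ j : ℝ≥0)) *
        ((C₁ * B * D * C₂ : ℝ≥0) * (H.toNNReal : ℝ≥0)) := by
        push_cast
        ring
    _ ≤ 2 * ((C₁ * B * D * C₂ : ℝ≥0) * (H.toNNReal : ℝ≥0)) := by gcongr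
    _ = _ := by
        rw [ENNReal.coe_toNNReal hf]
        push_cast
        ring

end DyadicPartition

/-! ### Convergence of the regularized products -/

theorem IsBoundedLipschitzDomain.isRepresentedBy_indicator {P : Set R3}
    (hP : IsBoundedLipschitzDomain P) :
    IsRepresentedBy (Lp.toTemperedDistribution hP.indicator) (P.indicator 1) 1 where
  measurable := measurable_one.indicator hP.isOpen.measurableSet
  enorm_le y := by
    by_cases hy : y ∈ P <;> simp [hy]
  apply_eq g := by
    rw [Lp.toTemperedDistribution_apply]
    refine integral_congr_ae ?_
    have h : hP.indicator =ᵐ[volume] P.indicator fun _ ↦ (1 : ℂ) := indicatorConstLp_coeFn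
    filter_upwards [h] with x hx
    rw [hx, smul_eq_mul]
    rfl

/-- A function of bounded support has a smooth Fourier transform, so a low frequency cut-off of it
is a Schwartz function. -/
theorem exists_schwartz_lowFreq_indicator {P : Set R3} (hP : IsBoundedLipschitzDomain P)
    (Ψ : DyadicPartition) (n : ℕ) : ∃ a : 𝓢(R3, ℂ),
      Function.HasTemperateGrowth.toTemperedDistribution volume a.hasTemperateGrowth =
        Ψ.lowFreq n (Lp.toTemperedDistribution hP.indicator) := by
  set u : R3 → ℂ := P.indicator 1
  have hrep := hP.isRepresentedBy_indicator
  have hmom : ∀ k : ℕ, Integrable fun v ↦ ‖v‖ ^ k * ‖u v‖ := by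
    intro k
    obtain ⟨R, hR⟩ := hP.isBounded.subset_closedBall 0
    have h1 : Integrable (P.indicator fun _ ↦ R ^ k) :=
      (integrable_indicator_iff hP.isOpen.measurableSet).2
        (integrableOn_const hP.isBounded.measure_lt_top.ne)
    refine h1.mono' ?_ (Eventually.of_forall fun v ↦ ?_)
    · have := hrep.measurable
      exact Measurable.aestronglyMeasurable (by fun_prop)
    · by_cases hv : v ∈ P
      · have : ‖v‖ ≤ R := by simpa using hR hv
        simp only [u, Set.indicator_of_mem hv, Pi.one_apply, norm_one, mul_one, norm_pow, norm_norm]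
        gcongr
      · simp [u, hv]
  have hint : Integrable u := by
    have := hmom 0
    simp only [pow_zero, one_mul] at this
    exact (integrable_norm_iff hrep.measurable.aestronglyMeasurable).1 this
  have hsmooth : ContDiff ℝ ∞ (𝓕 u) :=
    Real.contDiff_fourier (N := ⊤) fun k _ ↦ hmom k
  obtain ⟨τ, hτ, -⟩ := exists_schwartz_scaled Ψ.χSchwartz (l := 2 ^ n) (by positivity)
  have hsymb : (fun ξ ↦ (Ψ.χ (((2 : ℝ) ^ n)⁻¹ • ξ) : ℂ)) = τ := by
    funext ξ
    simp [hτ]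
  have hcs : HasCompactSupport τ := by
    rw [← hsymb]
    have h0 : (((2 : ℝ) ^ n)⁻¹) ≠ 0 := by positivity
    exact (Ψ.hasCompactSupport_χ.comp_smul h0).comp_left (g := Complex.ofReal) rfl
  let s : 𝓢(R3, ℂ) := (hcs.mul_right (f' := 𝓕 u)).toSchwartzMap ((τ.smooth _).mul hsmooth)
  refine ⟨𝓕⁻ s, ?_⟩
  ext g
  change ∫ x, g x • (𝓕⁻ s) x = _
  rw [DyadicPartition.lowFreq, hsymb, fourierMultiplierCLM_apply_apply, hrep.apply_eq]
  have h1 : ∫ x, g x • (𝓕⁻ s) x = ∫ x, (𝓕⁻ g) x * s x := by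
    simpa using (SchwartzMap.integral_fourierInv_mul_eq g s).symm
  have h2 := VectorFourier.integral_fourierIntegral_smul_eq_flip (L := innerₗ R3)
    Real.continuous_fourierChar continuous_inner
    ((SchwartzMap.smulLeftCLM ℂ τ (𝓕⁻ g)).integrable (μ := volume)) hint
  rw [flip_innerₗ] at h2
  rw [h1]
  refine Eq.trans ?_ h2.symm
  congr 1
  funext ξ
  rw [SchwartzMap.smulLeftCLM_apply_apply τ.hasTemperateGrowth]
  change _ * (τ ξ * 𝓕 u ξ) = (τ ξ * _) * 𝓕 u ξ
  ring

namespace DyadicPartition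

/-- The products of the low frequency cut-offs converge, block by block of `f`, to the products of
the limits, and the sum over the blocks is dominated uniformly by the pairing bound. -/
theorem tendsto_smulLeft_lowFreq (Ψ Ψ' : DyadicPartition) {r : ℝ} (hr₀ : 0 < r) (hr₁ : r < 1)
    {v : 𝓢'(R3, ℂ)} {u : R3 → ℂ} {B A : ℝ≥0} (hv : IsRepresentedBy v u A) (hu : HasBVBound B u)
    {a : ℕ → 𝓢(R3, ℂ)}
    (ha : ∀ n, Function.HasTemperateGrowth.toTemperedDistribution volume (a n).hasTemperateGrowth =
      Ψ'.lowFreq n v)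
    {f w : 𝓢'(R3, ℂ)} {H : ℝ≥0} {F : ℕ → R3 → ℂ}
    (hF : ∀ n, IsRepresentedBy (Ψ.block n f) (F n) ((2 ^ (1 - r)) ^ n * H))
    (hw : ∀ g, HasSum (fun n ↦ ∫ y, u y * g y * F n y) (w g)) :
    Tendsto (fun n ↦ smulLeftCLM ℂ (a n) (Ψ'.lowFreq n f)) atTop (𝓝 w) := by
  rw [PointwiseConvergenceCLM.tendsto_iff_forall_tendsto]
  intro g
  obtain ⟨C₁, hC₁⟩ := Ψ.exists_pairing_bound
  set q : ℝ≥0 := 2 ^ (1 - r) with hq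
  have hq1 : 1 < q := NNReal.one_lt_rpow one_lt_two (by linarith)
  have hq2 : q < 2 := by
    have : (2 : ℝ≥0) ^ (1 - r) < 2 ^ (1 : ℝ) :=
      NNReal.rpow_lt_rpow_of_exponent_lt one_lt_two (by linarith)
    rwa [NNReal.rpow_one] at this
  obtain ⟨C₂, hC₂⟩ := exists_tsum_min_mul_pow_le hq1 hq2
  obtain ⟨N, N₁, hk⟩ := exists_isKernel_schwartz (kernel Ψ'.χSchwartz)
  have h2 : ∀ n : ℕ, (2 : ℝ≥0) ^ n ≠ 0 := fun n ↦ by positivity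
  set k : ℕ → R3 → ℂ := fun n ↦ dilate (2 ^ n) (kernel Ψ'.χSchwartz)
  have hkn : ∀ n, IsKernel N ((2 ^ n)⁻¹ * N₁) (k n) := fun n ↦ hk.dilate (h2 n)
  have hlow : ∀ {h : 𝓢'(R3, ℂ)} {G : R3 → ℂ} {A : ℝ≥0}, IsRepresentedBy h G A → ∀ n,
      IsRepresentedBy (Ψ'.lowFreq n h) (conv (k n) G) (N * A) := fun hG n ↦
    hG.fourierMultiplier Ψ'.χSchwartz hk (h2 n) (fun ξ ↦ by simp)
  have hk1 : ∀ n, ∫ t, k n t = 1 := fun n ↦ by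
    obtain ⟨ρ, hρ, hball⟩ := Ψ'.exists_ball
    rw [integral_dilate (h2 n), integral_fourierInv_schwartz, χSchwartz_apply,
      (hball 0 (by simpa using hρ)).2, Complex.ofReal_one]
  have hae : ∀ n, a n =ᵐ[volume] conv (k n) u := fun n ↦ by
    have hrep : IsRepresentedBy (Ψ'.lowFreq n v) (a n)
        (SchwartzMap.seminorm ℝ 0 0 (a n)).toNNReal := by
      refine ⟨(a n).continuous.measurable, fun y ↦ ?_, fun g ↦ ?_⟩
      · rw [← ofReal_norm]
        exact ENNReal.ofReal_le_ofReal (SchwartzMap.norm_le_seminorm ℝ (a n) y)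
      · rw [← ha]
        rfl
    exact hrep.ae_eq (hlow hv n)
  have hg := isBump_schwartz g
  set D := 256 * (1 + weightMass) * (bumpSeminorm g).toNNReal
  let ag : ℕ → 𝓢(R3, ℂ) := fun n ↦ SchwartzMap.smulLeftCLM ℂ (a n) g
  have hag : ∀ n x, ag n x = a n x * g x := fun n x ↦
    SchwartzMap.smulLeftCLM_apply_apply (a n).hasTemperateGrowth g x
  let t : ℕ → ℕ → ℂ := fun n m ↦ Ψ'.lowFreq n (Ψ.block m f) (ag n)
  have hsum : ∀ n, smulLeftCLM ℂ (a n) (Ψ'.lowFreq n f) g = ∑' m, t n m := fun n ↦ by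
    obtain ⟨M, hM0, hM⟩ := Ψ.exists_lowFreq_eq_sum Ψ' n
    rw [tsum_eq_sum (s := Finset.range M), smulLeftCLM_apply_apply, hM, sum_apply]
    intro m hm
    simp only [Finset.mem_range, not_lt] at hm
    simp only [t]
    rw [hM0 m hm, zero_apply]
  have hbound : ∀ n m, ‖t n m‖ ≤ ((C₁ * (N * H) * (N * B) * D : ℝ≥0) : ℝ) *
      (min 1 ((2 : ℝ≥0) ^ 0 / 2 ^ m) * q ^ m : ℝ≥0) := by
    intro n m
    have h := hC₁ ((isLocalized_block m f).lowFreq Ψ' n) (hlow (hF m) n) (hu.conv (hkn n)) hg le_rfl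
    have e : t n m = ∫ y, conv (k n) u y * g y * conv (k n) (F m) y := by
      simp only [t]
      rw [(hlow (hF m) n).apply_eq]
      refine integral_congr_ae ?_
      filter_upwards [hae n] with y hy
      rw [hag, hy]
    rw [← e, enorm_eq_nnnorm, ENNReal.coe_le_coe, ← NNReal.coe_le_coe, coe_nnnorm] at h
    refine h.trans_eq ?_
    rw [pow_zero, ← NNReal.coe_mul, NNReal.coe_inj]
    ring
  have hlim : ∀ m, Tendsto (fun n ↦ t n m) atTop (𝓝 (∫ y, u y * g y * F m y)) := by
    intro m
    obtain ⟨M, hM⟩ := Ψ.exists_lowFreq_block_eq Ψ' m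
    rw [tendsto_iff_norm_sub_tendsto_zero]
    have h0 : Tendsto (fun n : ℕ ↦ ((N₁ * B * D * (q ^ m * H) : ℝ≥0) : ℝ) * (2⁻¹ : ℝ) ^ n) atTop
        (𝓝 0) := by
      have := (tendsto_pow_atTop_nhds_zero_of_lt_one (r := (2⁻¹ : ℝ)) (by norm_num)
        (by norm_num)).const_mul ((N₁ * B * D * (q ^ m * H) : ℝ≥0) : ℝ)
      rwa [mul_zero] at this
    refine squeeze_zero' (Eventually.of_forall fun _ ↦ norm_nonneg _) ?_ h0
    filter_upwards [eventually_ge_atTop M] with n hn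
    have hFle : ∀ᵐ y, ‖F m y‖ ≤ (q ^ m * H : ℝ≥0) := Eventually.of_forall fun y ↦ by
      have := (hF m).enorm_le y
      rwa [enorm_eq_nnnorm, ENNReal.coe_le_coe] at this
    have i1 : Integrable fun y ↦ ag n y * F m y :=
      (ag n).integrable.mul_bdd (hF m).measurable.aestronglyMeasurable hFle
    have i2 : Integrable fun y ↦ u y * g y * F m y := by
      refine Integrable.mul_bdd ⟨(hu.measurable.mul hg.measurable).aestronglyMeasurable, ?_⟩
        (hF m).measurable.aestronglyMeasurable hFle
      exact (hu.lintegral_enorm_mul_le hg one_ne_zero).trans_lt (by finiteness)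
    have e : t n m - ∫ y, u y * g y * F m y = ∫ y, (conv (k n) u y - u y) * g y * F m y := by
      simp only [t]
      rw [hM n hn, (hF m).apply_eq, ← integral_sub i1 i2]
      refine integral_congr_ae ?_
      filter_upwards [hae n] with y hy
      rw [hag, hy]
      ring
    have hle : ‖t n m - ∫ y, u y * g y * F m y‖ₑ ≤
        (((2 ^ n)⁻¹ * N₁ * B * D * (q ^ m * H) : ℝ≥0) : ℝ≥0∞) := by
      rw [e]
      calc _ ≤ ∫⁻ y, ‖(conv (k n) u y - u y) * g y * F m y‖ₑ := enorm_integral_le_lintegral_enorm _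
        _ ≤ ∫⁻ y, ‖(conv (k n) u y - u y) * g y‖ₑ * (q ^ m * H : ℝ≥0) := by
            gcongr with y
            rw [enorm_mul (_ * g y)]
            gcongr
            exact (hF m).enorm_le y
        _ = (∫⁻ y, ‖(conv (k n) u y - u y) * g y‖ₑ) * (q ^ m * H : ℝ≥0) :=
            lintegral_mul_const' _ _ (by finiteness)
        _ ≤ (((2 ^ n)⁻¹ * N₁ : ℝ≥0) * B * D) * (q ^ m * H : ℝ≥0) := by
            gcongr
            exact hu.lintegral_conv_sub_mul_le (hkn n) (hk1 n) hg
        _ = _ := by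
            push_cast
            ring
    rw [enorm_eq_nnnorm, ENNReal.coe_le_coe, ← NNReal.coe_le_coe, coe_nnnorm] at hle
    refine hle.trans_eq ?_
    push_cast
    rw [inv_pow]
    ring
  simp_rw [hsum]
  rw [← (hw g).tsum_eq]
  exact tendsto_tsum_of_dominated_convergence
    ((NNReal.summable_coe.2 (hC₂ 0).1).mul_left _) hlim (Eventually.of_forall hbound)

end DyadicPartition

end

theorem mainTheorem5 (P : Set R3) (hP : IsBoundedLipschitzDomain P) (r : ℝ) (hr₀ : 0 < r)
    (hr₁ : r < 1) (Ψ : DyadicPartition) :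
    ∃ M : HolderSpace Ψ (r - 1) →L[ℂ] HolderSpace Ψ (r - 1), ∀ f : HolderSpace Ψ (r - 1),
      IsProduct (Lp.toTemperedDistribution hP.indicator) (HolderSpace.toDistribution Ψ (r - 1) f)
        (HolderSpace.toDistribution Ψ (r - 1) (M f)) := by
  obtain ⟨B, hB⟩ := hP.exists_hasBVBound_indicator
  have hrep := hP.isRepresentedBy_indicator
  obtain ⟨C, hC⟩ := Ψ.exists_product_series hr₀ hr₁ hB
  choose a ha using fun Ψ' n ↦ exists_schwartz_lowFreq_indicator hP Ψ' n
  have hex : ∀ f : HolderSpace Ψ (r - 1), ∃ w : HolderSpace Ψ (r - 1), ‖w‖ ≤ C * ‖f‖ ∧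
      ∀ Ψ' : DyadicPartition, Tendsto (fun n ↦ smulLeftCLM ℂ (a Ψ' n)
        (Ψ'.lowFreq n (HolderSpace.toDistribution Ψ (r - 1) f))) atTop
        (𝓝 (HolderSpace.toDistribution Ψ (r - 1) w)) := by
    intro f
    have hf := HolderSpace.holderNorm_ne_top Ψ (r - 1) f
    obtain ⟨w, hw, F, hF, hwF⟩ := hC _ hf
    refine ⟨⟨w, hw.trans_lt (ENNReal.mul_lt_top ENNReal.coe_lt_top hf.lt_top)⟩, ?_, fun Ψ' ↦ ?_⟩
    · have := ENNReal.toReal_mono (ENNReal.mul_ne_top ENNReal.coe_ne_top hf) hw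
      rwa [ENNReal.toReal_mul] at this
    · exact Ψ.tendsto_smulLeft_lowFreq Ψ' hr₀ hr₁ hrep hB (ha Ψ') hF hwF
  choose M hM hlim using hex
  have hinj : Function.Injective (HolderSpace.toDistribution Ψ (r - 1)) :=
    Subtype.val_injective
  -- linearity holds because limits are unique
  let M' : HolderSpace Ψ (r - 1) →ₗ[ℂ] HolderSpace Ψ (r - 1) :=
    { toFun := M
      map_add' := fun f g ↦ by
        apply hinj
        refine tendsto_nhds_unique (hlim (f + g) Ψ) ?_
        simp_rw [map_add]
        exact (hlim f Ψ).add (hlim g Ψ)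
      map_smul' := fun c f ↦ by
        apply hinj
        refine tendsto_nhds_unique (hlim (c • f) Ψ) ?_
        simp_rw [map_smul]
        exact (hlim f Ψ).const_smul c }
  exact ⟨M'.mkContinuous C hM, fun f Ψ' ↦
    ⟨fun n ↦ a Ψ' n, fun n ↦ (a Ψ' n).hasTemperateGrowth, ha Ψ', hlim f Ψ'⟩⟩
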